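/- Let $X=(\Omega,\mathcal F,\mathcal F_t,X_t,\theta_t,P_x)$ be a time-homogeneous right-continuous strong Markov process with state space $E$, possibly killed at a finite lifetime (after which it stays at a cemetery point), where $(\mathcal F_t)$ is right-continuous. For every $y\in E$ let $(L^y_t)_{t\ge 0}$ be a local time of $X$ at $y$, that is, a continuous additive functional of $X$ (adapted, almost surely continuous and nondecreasing with $L^y_0=0$, constant after the lifetime, and almost surely $L^y_{t+s}=L^y_t+L^y_s\circ\theta_t$ for all $s,t\ge 0$) such that for every starting point $x\neq y$, $P_x(\inf\{t: L^y_t>0\}=0)=0$; the zero functional is allowed. Let $g(x,y)=E_x(L^y_\infty)$, $x,y\in E$, be the Green function, where $L^y_\infty=\lim_{t\to\infty}L^y_t$, and assume that $X$ is transient, that is, $g(x,y)<\infty$ for all $x,y\in E$. Then for every $\beta>0$ there exists, on some probability space, a positive (that is, nonnegative real-valued) process $(\psi_x,\ x\in E)$ such that for every $n$, every $(\alpha_1,\dots,\alpha_n)\in\mathbb R_+^n$ and every $(x_1,\dots,x_n)\in E^n$, $$|I+\alpha G|>0\quad\text{and}\quad \mathbb E\Big[\exp\Big\{-\tfrac12\sum_{i=1}^n\alpha_i\psi_{x_i}\Big\}\Big]=|I+\alpha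 G|^{-1/\beta},$$ where $|\cdot|$ denotes the determinant, $I$ is the $n\times n$ identity matrix, $\alpha=\mathrm{diag}(\alpha_i)_{1\le i\le n}$ and $G=(g(x_i,x_j))_{1\le i,j\le n}$. That is, there exists a permanental process with kernel $g$ and index $\beta$ (the permanental process with index $\beta$ associated to $X$). -/

import Mathlib

open MeasureTheory ProbabilityTheory Set
open scoped NNReal ENNReal

universe u v

/-- The state space `E` with an isolated cemetery point adjoined. A process that is killed (has a
finite lifetime) takes values in this space. -/
abbrev WithCemetery (E : Type*) : Type _ := E ⊕ Unit

/-- The cemetery point. -/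
abbrev cemetery {E : Type*} : WithCemetery E := Sum.inr ()

/-- A time-homogeneous right-continuous strong Markov process
`(Ω, 𝓕, 𝓕_t, X_t, θ_t, P_x)` with state space `E`, possibly killed at a finite lifetime.
The σ-algebra of `E` contains the Borel sets; it may be larger (for instance, the universally
measurable sets), and `𝓕_t` may be an augmented filtration. -/
structure StrongMarkovProcess (E Ω : Type*) [TopologicalSpace E] [MeasurableSpace E]
    [OpensMeasurableSpace E] [mΩ : MeasurableSpace Ω] where
  /-- the filtration `𝓕_t` -/
  filtration : Filtration ℝ≥0 mΩ
  /-- the process `X_t` -/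
  X : ℝ≥0 → Ω → WithCemetery E
  /-- the shift operators `θ_t` -/
  shift : ℝ≥0 → Ω → Ω
  /-- the law `P_x` under which the process starts at `x` -/
  P : Kernel (WithCemetery E) Ω
  isMarkovKernel : IsMarkovKernel P
  filtration_rightContinuous : filtration.IsRightContinuous
  measurable_X : ∀ t, Measurable[filtration t] (X t)
  rightContinuous_X : ∀ ω t, ContinuousWithinAt (fun s => X s ω) (Ici t) t
  /-- the cemetery is absorbing -/
  absorbed : ∀ ω s t, s ≤ t → X s ω = cemetery → X t ω = cemetery
  measurable_shift : ∀ t, Measurable (shift t)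
  X_shift : ∀ s t ω, X s (shift t ω) = X (t + s) ω
  start : ∀ x, ∀ᵐ ω ∂(P x), X 0 ω = x
  /-- `X_T` is `𝓕_T`-measurable on `{T < ∞}`, for every stopping time `T` -/
  measurable_X_stopping : ∀ (T : Ω → WithTop ℝ≥0) (hT : IsStoppingTime filtration T)
    (B : Set (WithCemetery E)), MeasurableSet B →
      MeasurableSet[hT.measurableSpace] {ω | T ω ≠ ⊤ ∧ X ((T ω).untopD 0) ω ∈ B}
  /-- the strong Markov property: for every stopping time `T`, every `A ∈ 𝓕_T` and `Γ ∈ 𝓕`,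
  `P_x(A, T < ∞, θ_T ∈ Γ) = E_x(P_{X_T}(Γ); A, T < ∞)` -/
  strong_markov : ∀ (T : Ω → WithTop ℝ≥0) (hT : IsStoppingTime filtration T)
    (x : WithCemetery E) (A Γ : Set Ω), MeasurableSet[hT.measurableSpace] A → MeasurableSet Γ →
      P x (A ∩ {ω | T ω ≠ ⊤ ∧ shift ((T ω).untopD 0) ω ∈ Γ}) =
        ∫⁻ ω in A ∩ {ω | T ω ≠ ⊤}, P (X ((T ω).untopD 0) ω) Γ ∂(P x)

namespace StrongMarkovProcess

variable {E Ω : Type*} [TopologicalSpace E] [MeasurableSpace E] [OpensMeasurableSpace E]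
  [MeasurableSpace Ω]

/-- `A` is a continuous additive functional of the process. "Almost surely" means `P_x`-almost
surely for every `x`. -/
structure IsContinuousAdditiveFunctional (M : StrongMarkovProcess E Ω) (A : ℝ≥0 → Ω → ℝ≥0) :
    Prop where
  adapted : ∀ t, Measurable[M.filtration t] (A t)
  zero : ∀ x, ∀ᵐ ω ∂(M.P x), A 0 ω = 0
  monotone : ∀ x, ∀ᵐ ω ∂(M.P x), Monotone fun t => A t ω
  continuous : ∀ x, ∀ᵐ ω ∂(M.P x), Continuous fun t => A t ω
  additive : ∀ x, ∀ᵐ ω ∂(M.P x), ∀ s t, A (t + s) ω = A t ω + A s (M.shift t ω)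
  /-- `A` is constant from the lifetime on -/
  constant_of_dead : ∀ x, ∀ᵐ ω ∂(M.P x), ∀ s t, s ≤ t → M.X s ω = cemetery → A t ω = A s ω

/-- `A` is a local time at `y`: a continuous additive functional that, from a starting point other
than `y`, almost surely does not increase immediately, i.e. whose support
`{x | P_x(inf {t | A_t > 0} = 0) = 1}` is contained in `{y}`. (By the zero-one law the support is
`{y}` unless `A` vanishes; the zero functional is allowed, as the local time at a point that is
not regular for itself. No normalization is imposed.) -/
structure IsLocalTimeAt (M : StrongMarkovProcess E Ω) (y : E) (A : ℝ≥0 → Ω → ℝ≥0) : Prop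
    extends M.IsContinuousAdditiveFunctional A where
  support : ∀ x : WithCemetery E, x ≠ Sum.inl y → ∀ᵐ ω ∂(M.P x), ∃ t, 0 < t ∧ A t ω = 0

/-- The Green function `g(x, y) = E_x(L^y_∞)`, where `L^y_∞ = lim_t L^y_t = sup_t L^y_t`, as an
extended nonnegative number. -/
noncomputable def green (M : StrongMarkovProcess E Ω) (L : E → ℝ≥0 → Ω → ℝ≥0) (x y : E) : ℝ≥0∞ :=
  ∫⁻ ω, ⨆ t, (L y t ω : ℝ≥0∞) ∂(M.P (Sum.inl x))

/-- Transience of a process with local times `L`: the Green function is finite. -/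
def IsTransient (M : StrongMarkovProcess E Ω) (L : E → ℝ≥0 → Ω → ℝ≥0) : Prop :=
  ∀ x y, M.green L x y < ∞

end StrongMarkovProcess

/-- `ψ`, a process on a probability space `(Ω', μ)` indexed by `E`, is a permanental process with
kernel `g` and index `β`: it is nonnegative, and its finite-dimensional Laplace transforms are
`E[exp(-(1/2) ∑ᵢ αᵢ ψ_{xᵢ})] = |I + α G|^{-1/β}` with `G = (g(xᵢ, xⱼ))`, where the determinant is
positive, so that its real power is meaningful. -/
structure IsPermanentalProcess {E Ω' : Type*} [MeasurableSpace Ω'] (μ : Measure Ω')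
    (ψ : E → Ω' → ℝ) (g : E → E → ℝ) (β : ℝ) : Prop where
  measurable : ∀ x, Measurable (ψ x)
  nonneg : ∀ x ω, 0 ≤ ψ x ω
  det_pos : ∀ (n : ℕ) (α : Fin n → ℝ) (x : Fin n → E), (∀ i, 0 ≤ α i) →
    0 < (1 + Matrix.diagonal α * Matrix.of fun i j => g (x i) (x j)).det
  laplace : ∀ (n : ℕ) (α : Fin n → ℝ) (x : Fin n → E), (∀ i, 0 ≤ α i) →
    ∫ ω, Real.exp (-(1 / 2) * ∑ i, α i * ψ (x i) ω) ∂μ =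
      (1 + Matrix.diagonal α * Matrix.of fun i j => g (x i) (x j)).det ^ (-1 / β)

/-!
The Laplace transform `a ↦ |I + αG| ^ (-1/β)` is built from elementary ones by operations that
preserve Laplace transforms, once the resolvents of the Green function are known to be nonnegative.

**Nonnegative resolvents.** Let `F` be a finite set of points and let the clock be the sum of the
local times at the points of `F`. Let `P_h(x, z)` be the probability that the clock exceeds `h` and
that the process is at `z` at that moment; at such a moment the process is in `F`, since elsewhere
no local time increases. The strong Markov property at this single time gives `G = W_h + P_h G`
(`green_eq_add_sum`), where `W_h` is the local time collected while the clock runs up to `h`. Only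
the local time at the current position increases, so `W_h / h → P_0` as `h → 0`
(`tendsto_lintegral_valueAtLevel`), and `P_0 G = G`. Hence the discrete resolvents of `P_h`, which
are nonnegative as Neumann series, applied to `W_h` converge along a subsequence to a matrix
`U ≥ 0` with `U (I + rG) = G` (`exists_nonneg_resolvent`).

**Finite sets.** With `Q = rU ≥ 0` one has `(I - Q)(I + rG) = I`, and for a diagonal matrix `S`
`I + r(I - S)G = (I - SQ)(I + rG)`. For `0 ≤ S ≤ I` elimination writes `|I - SQ|` as a product of
factors `1 - φ`, where `φ < 1` is a power series with nonnegative coefficients in the entries of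
`S` (`isMixture_det_one_sub_rpow`), and `(1 - φ) ^ (-1/β)` is again such a power series.
Substituting `S = exp (-α / r)` and letting `r → ∞` gives `|I + αG| ^ (-1/β)`
(`isMixture_det_one_add_rpow`).

**The process.** The exponentials `exp (-(1/2) ∑ aₓ ψₓ)` are the characters `∏ uₓ ^ aₓ` of the
compact monoid `[0, 1] ^ E` in the variable `u = exp (-ψ / 2)`. A function of `a` is called a
mixture of characters if it defines a positive functional on their span (`IsMixture`). This is
trivially stable under sums, products and pointwise limits, and it concerns only finitely many points at a
time, so the finite sets fit together. The theorems of M. Riesz and Riesz–Markov–Kakutani then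
produce a measure on `[0, 1] ^ E` (`IsMixture.exists_measure`) under which `ψ = -2 log u` is the
required process; `u > 0` almost surely because the Laplace transform is continuous at `0`.
-/

open Filter Topology

/-! ### Mixtures of characters -/

/-- `φ` is a mixture of the characters `χ a`, stated dually: replacing every `χ a` by `φ a` in a
finite linear combination of characters that is nonnegative on `K` gives a nonnegative number.
If `K` is compact and the characters are continuous, this means `φ a = ∫ χ a dμ` for a finite
measure `μ` on `K`; the dual form makes the closure properties below immediate. -/
def IsMixture {A K : Type*} [Monoid K] (χ : A → K →* ℝ) (φ : A → ℝ) : Prop :=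
  ∀ c : A →₀ ℝ, (∀ u, 0 ≤ c.sum fun a t => t * χ a u) → 0 ≤ c.sum fun a t => t * φ a

namespace IsMixture

variable {A K : Type*} [Monoid K] {χ : A → K →* ℝ} {φ φ' : A → ℝ}

theorem eval (u : K) : IsMixture χ fun a => χ a u := fun _ h => h u

theorem one : IsMixture χ fun _ => 1 := by
  simpa using eval (χ := χ) 1

theorem nonneg (hχ : ∀ a u, 0 ≤ χ a u) (h : IsMixture χ φ) (a : A) : 0 ≤ φ a := by
  have := h (Finsupp.single a 1) (fun u => by simpa using hχ a u)
  simpa using this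

theorem add (h : IsMixture χ φ) (h' : IsMixture χ φ') : IsMixture χ fun a => φ a + φ' a := by
  intro c hc
  have := add_nonneg (h c hc) (h' c hc)
  simpa only [Finsupp.sum, mul_add, Finset.sum_add_distrib] using this

theorem smul (h : IsMixture χ φ) {r : ℝ} (hr : 0 ≤ r) : IsMixture χ fun a => r * φ a := by
  intro c hc
  have := mul_nonneg hr (h c hc)
  simpa only [Finsupp.sum, Finset.mul_sum, mul_left_comm] using this

theorem const {r : ℝ} (hr : 0 ≤ r) : IsMixture χ fun _ => r := by
  simpa using (one (χ := χ)).smul hr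

/-- Products correspond to the multiplicative convolution of mixing measures: first freeze one
factor at a point `u`, where `χ a (u * v) = χ a u * χ a v`. -/
theorem mul (h : IsMixture χ φ) (h' : IsMixture χ φ') : IsMixture χ fun a => φ a * φ' a := by
  classical
  intro c hc
  -- absorb one factor into the coefficients
  have twist : ∀ f g : A → ℝ,
      (Finsupp.onFinset c.support (fun a => c a * f a) (by
        intro a ha; simp only [ne_eq, mul_eq_zero, not_or] at ha; simpa using ha.1)).sum
        (fun a t => t * g a) = c.sum fun a t => t * (f a * g a) := by
    intro f g
    rw [Finsupp.onFinset_sum _ (by simp)]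
    simp only [Finsupp.sum, mul_assoc]
  have h1 : ∀ u, 0 ≤ c.sum fun a t => t * (χ a u * φ' a) := by
    intro u
    rw [← twist (fun a => χ a u) φ']
    refine h' _ fun v => ?_
    rw [twist (fun a => χ a u) (fun a => χ a v)]
    simpa only [map_mul] using hc (u * v)
  have h2 := h (Finsupp.onFinset c.support (fun a => c a * φ' a) (by
        intro a ha; simp only [ne_eq, mul_eq_zero, not_or] at ha; simpa using ha.1))
    (fun u => by
      rw [twist φ' (fun a => χ a u)]
      simpa only [mul_comm (φ' _)] using h1 u)
  rw [twist φ' φ] at h2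
  simpa only [mul_comm (φ' _)] using h2

theorem pow (h : IsMixture χ φ) (n : ℕ) : IsMixture χ fun a => φ a ^ n := by
  induction n with
  | zero => simpa using one
  | succ n ih => simpa only [pow_succ] using ih.mul h

theorem sum {ι : Type*} (s : Finset ι) {f : ι → A → ℝ} (h : ∀ i ∈ s, IsMixture χ (f i)) :
    IsMixture χ fun a => ∑ i ∈ s, f i a := by
  classical
  induction s using Finset.induction_on with
  | empty => simpa using const (χ := χ) le_rfl
  | insert i s hi ih =>
    simp only [Finset.sum_insert hi]
    exact (h i (by simp)).add (ih fun j hj => h j (by simp [hj]))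

theorem of_tendsto {ι : Type*} {l : Filter ι} [l.NeBot] {f : ι → A → ℝ}
    (h : ∀ᶠ i in l, IsMixture χ (f i)) (hf : ∀ a, Tendsto (fun i => f i a) l (𝓝 (φ a))) :
    IsMixture χ φ := by
  intro c hc
  have : Tendsto (fun i => c.sum fun a t => t * f i a) l (𝓝 (c.sum fun a t => t * φ a)) :=
    tendsto_finsetSum _ fun a _ => (hf a).const_mul _
  exact ge_of_tendsto this (h.mono fun i hi => hi c hc)

theorem of_hasSum {f : ℕ → A → ℝ} (h : ∀ n, IsMixture χ (f n))
    (hf : ∀ a, HasSum (fun n => f n a) (φ a)) : IsMixture χ φ :=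
  of_tendsto (l := atTop) (f := fun N a => ∑ n ∈ Finset.range N, f n a)
    (.of_forall fun _ => sum _ fun n _ => h n) fun a => (hf a).tendsto_sum_nat

theorem exp (h : IsMixture χ φ) : IsMixture χ fun a => Real.exp (φ a) := by
  refine of_hasSum (f := fun n a => (n.factorial : ℝ)⁻¹ * φ a ^ n)
    (fun n => (h.pow n).smul (by positivity)) fun a => ?_
  have := NormedSpace.exp_series_hasSum_exp' (𝕂 := ℝ) (φ a)
  rw [← Real.exp_eq_exp_ℝ] at this
  simpa only [smul_eq_mul] using this

theorem one_sub_inv (hχ : ∀ a u, 0 ≤ χ a u) (h : IsMixture χ φ) (h1 : ∀ a, φ a < 1) :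
    IsMixture χ fun a => (1 - φ a)⁻¹ :=
  of_hasSum (fun n => h.pow n) fun a => hasSum_geometric_of_lt_one (h.nonneg hχ a) (h1 a)

/-- The binomial series of `(1 - x) ^ (-p)` has nonnegative coefficients. -/
theorem one_sub_rpow_neg (hχ : ∀ a u, 0 ≤ χ a u) (h : IsMixture χ φ) (h1 : ∀ a, φ a < 1) {p : ℝ}
    (hp : 0 ≤ p) : IsMixture χ fun a => (1 - φ a) ^ (-p) := by
  have hlog : IsMixture χ fun a => -Real.log (1 - φ a) := by
    refine of_hasSum (f := fun n a => ((n : ℝ) + 1)⁻¹ * φ a ^ (n + 1))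
      (fun n => (h.pow _).smul (by positivity)) fun a => ?_
    have := Real.hasSum_pow_div_log_of_abs_lt_one (x := φ a)
      (by rw [abs_of_nonneg (h.nonneg hχ a)]; exact h1 a)
    simpa only [div_eq_inv_mul] using this
  convert (hlog.smul hp).exp using 2 with a
  rw [Real.rpow_def_of_pos (by linarith [h1 a])]
  congr 1; ring

end IsMixture

/-! ### Determinants of matrices of mixtures -/

/-- If the nonnegative matrix `B` has a strictly positive vector `w` with `B w < w`, then
`det (1 - B) > 0`; and if the entries are mixtures, so are the negative powers of the determinant.
Eliminating one index at a time, the determinant is a product of factors `1 - φ`, where `φ < 1` is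
a diagonal entry of a successive Schur complement; these again have mixtures as entries. -/
theorem isMixture_det_one_sub_rpow {A K : Type*} [Monoid K] {χ : A → K →* ℝ}
    (hχ : ∀ a u, 0 ≤ χ a u) {p : ℝ} (hp : 0 ≤ p) (ι : Type*) [Fintype ι] [DecidableEq ι]
    (B : A → Matrix ι ι ℝ) (hB : ∀ i j, IsMixture χ fun a => B a i j)
    (w : A → ι → ℝ) (hw : ∀ a i, 0 < w a i) (hBw : ∀ a i, ∑ j, B a i j * w a j < w a i) :
    (∀ a, 0 < (1 - B a).det) ∧ IsMixture χ fun a => (1 - B a).det ^ (-p) := by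
  classical
  have main : ∀ n (ι : Type) [Fintype ι] [DecidableEq ι], Fintype.card ι = n →
      ∀ (B : A → Matrix ι ι ℝ) (hB : ∀ i j, IsMixture χ fun a => B a i j)
      (w : A → ι → ℝ) (hw : ∀ a i, 0 < w a i) (hBw : ∀ a i, ∑ j, B a i j * w a j < w a i),
      (∀ a, 0 < (1 - B a).det) ∧ IsMixture χ fun a => (1 - B a).det ^ (-p) := by
    intro n
    induction n with
    | zero =>
      intro ι _ _ hι B _ _ _ _
      have := Fintype.card_eq_zero_iff.mp hι
      simpa using IsMixture.one
    | succ n ih =>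
      intro ι _ _ hι B hB w hw hBw
      let e : Unit ⊕ Fin n ≃ ι := Fintype.equivOfCardEq (by simp [hι, add_comm])
      have hnn : ∀ a i j, 0 ≤ B a i j := fun a i j => (hB i j).nonneg hχ a
      set b : A → ℝ := fun a => B a (e (.inl ())) (e (.inl ())) with hb
      have hsum : ∀ a i, B a i (e (.inl ())) * w a (e (.inl ())) +
          ∑ j, B a i (e (.inr j)) * w a (e (.inr j)) < w a i := by
        intro a i
        have := hBw a i
        rw [← e.sum_comp, Fintype.sum_sum_type] at this
        simpa using this
      have hpos : ∀ a i, 0 ≤ ∑ j, B a i (e (.inr j)) * w a (e (.inr j)) := fun a i =>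
        Finset.sum_nonneg fun j _ => mul_nonneg (hnn _ _ _) (hw _ _).le
      have hb1 : ∀ a, b a < 1 := by
        intro a
        have h1 := hsum a (e (.inl ()))
        have h2 := hpos a (e (.inl ()))
        have h3 := hw a (e (.inl ()))
        simp only [hb]
        by_contra hcon
        nlinarith
      -- the Schur complement
      let C : A → Matrix (Fin n) (Fin n) ℝ := fun a => Matrix.of fun i j =>
        B a (e (.inr i)) (e (.inr j)) +
          B a (e (.inr i)) (e (.inl ())) * (1 - b a)⁻¹ * B a (e (.inl ())) (e (.inr j))
      have hdet : ∀ a, (1 - B a).det = (1 - b a) * (1 - C a).det := by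
        intro a
        have h0 : 1 - b a ≠ 0 := by linarith [hb1 a]
        let M₁₁ : Matrix Unit Unit ℝ := Matrix.of fun _ _ => 1 - b a
        have hd : M₁₁.det = 1 - b a := by simp [M₁₁]
        have : Invertible M₁₁ := Matrix.invertibleOfIsUnitDet _ (by rw [hd]; exact h0.isUnit)
        have hinv : ⅟M₁₁ = Matrix.of fun _ _ => (1 - b a)⁻¹ := by
          apply invOf_eq_right_inv
          ext i j
          simp [M₁₁, Matrix.mul_apply, h0]
        have hblock : (1 - B a).submatrix e e = Matrix.fromBlocks M₁₁
            (Matrix.of fun _ j => -B a (e (.inl ())) (e (.inr j)))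
            (Matrix.of fun i _ => -B a (e (.inr i)) (e (.inl ())))
            (1 - Matrix.of fun i j => B a (e (.inr i)) (e (.inr j))) := by
          ext i j
          rcases i with i | i <;> rcases j with j | j <;>
            simp [M₁₁, b, Matrix.one_apply]
        rw [← Matrix.det_submatrix_equiv_self e, hblock, Matrix.det_fromBlocks₁₁, hd, hinv]
        congr 2
        ext i j
        simp only [C, Matrix.sub_apply, Matrix.mul_apply, Matrix.of_apply, Finset.univ_unique,
          Finset.sum_singleton]
        ring
      obtain ⟨hp1, hp2⟩ := ih (Fin n) (by simp) C
        (fun i j => (hB _ _).add (((hB _ _).mul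
          ((hB _ _).one_sub_inv hχ hb1)).mul (hB _ _)))
        (fun a i => w a (e (.inr i))) (fun a i => hw _ _) (by
          intro a i
          have h0 : 0 < 1 - b a := by linarith [hb1 a]
          have h1 := hsum a (e (.inl ()))
          have h2 := hsum a (e (.inr i))
          simp only [C, Matrix.of_apply, add_mul, Finset.sum_add_distrib]
          have h3 : ∑ j, B a (e (.inr i)) (e (.inl ())) * (1 - b a)⁻¹ *
              B a (e (.inl ())) (e (.inr j)) * w a (e (.inr j)) =
              B a (e (.inr i)) (e (.inl ())) * ((1 - b a)⁻¹ *
              ∑ j, B a (e (.inl ())) (e (.inr j)) * w a (e (.inr j))) := by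
            simp only [Finset.mul_sum, mul_assoc]
          have h4 : (1 - b a)⁻¹ * ∑ j, B a (e (.inl ())) (e (.inr j)) * w a (e (.inr j)) ≤
              w a (e (.inl ())) := by
            rw [inv_mul_le_iff₀ h0]
            simp only [hb] at *
            linarith
          rw [h3]
          have := mul_le_mul_of_nonneg_left h4 (hnn a (e (.inr i)) (e (.inl ())))
          linarith)
      refine ⟨fun a => ?_, ?_⟩
      · rw [hdet]; exact mul_pos (by linarith [hb1 a]) (hp1 a)
      · have := ((hB (e (.inl ())) (e (.inl ()))).one_sub_rpow_neg hχ hb1 hp).mul hp2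
        convert this using 2 with a
        rw [hdet, Real.mul_rpow (by linarith [hb1 a]) (hp1 a).le]
  let e := Fintype.equivFin ι
  have := main _ (Fin (Fintype.card ι)) rfl (fun a => (B a).submatrix e.symm e.symm)
    (fun i j => hB _ _) (fun a i => w a (e.symm i)) (fun a i => hw _ _) (by
      intro a i
      have := hBw a (e.symm i)
      rwa [← e.symm.sum_comp] at this)
  have h2 : ∀ a, (1 - (B a).submatrix e.symm e.symm).det = (1 - B a).det := by
    intro a
    rw [← Matrix.det_submatrix_equiv_self e.symm (1 - B a)]
    congr 1
    ext i j
    simp [Matrix.one_apply]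
  simpa only [h2] using this

/-! ### Representation of mixtures by measures -/

/-- On a compact monoid a mixture of continuous characters is integration against a measure: the
functional `∑ c a • χ a ↦ ∑ c a * φ a` is well defined and positive on the span of the characters,
extends to a positive functional by M. Riesz's theorem, and is represented by a measure by the
Riesz–Markov–Kakutani theorem. -/
theorem IsMixture.exists_measure {A K : Type*} [Monoid K] [TopologicalSpace K] [CompactSpace K]
    [T2Space K] [MeasurableSpace K] [BorelSpace K] {χ : A → K →* ℝ} {φ : A → ℝ}
    (hcont : ∀ a, Continuous (χ a)) (h : IsMixture χ φ) (o : A) (ho : ∀ u, χ o u = 1)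
    (ho1 : φ o = 1) :
    ∃ μ : Measure K, IsProbabilityMeasure μ ∧ ∀ a, ∫ u, χ a u ∂μ = φ a := by
  classical
  let X : A → C(K, ℝ) := fun a => ⟨χ a, hcont a⟩
  let Φ : (A →₀ ℝ) →ₗ[ℝ] C(K, ℝ) := Finsupp.linearCombination ℝ X
  let F : (A →₀ ℝ) →ₗ[ℝ] ℝ := Finsupp.linearCombination ℝ φ
  have hΦ : ∀ c u, Φ c u = c.sum fun a t => t * χ a u := by
    intro c u
    simp [Φ, X, Finsupp.linearCombination_apply, Finsupp.sum, ContinuousMap.sum_apply]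
  have hF : ∀ c, F c = c.sum fun a t => t * φ a := by
    intro c; simp [F, Finsupp.linearCombination_apply]
  have hpos : ∀ c, (∀ u, 0 ≤ Φ c u) → 0 ≤ F c := by
    intro c hc
    rw [hF]
    exact h c fun u => by rw [← hΦ]; exact hc u
  have hker : F ∈ (LinearMap.ker Φ).dualAnnihilator := by
    rw [Submodule.mem_dualAnnihilator]
    intro c hc
    rw [LinearMap.mem_ker] at hc
    refine le_antisymm ?_ (hpos c fun u => by simp [hc])
    have := hpos (-c) fun u => by simp [hc]
    simpa using this
  rw [← LinearMap.range_dualMap_eq_dualAnnihilator_ker] at hker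
  obtain ⟨f, hf⟩ := hker
  have hf' : ∀ c, f (Φ c) = F c := fun c => by rw [← hf]; rfl
  have hX : ∀ a, Φ (Finsupp.single a 1) = X a := fun a => by simp [Φ]
  have hX1 : X o = 1 := by ext u; exact ho u
  obtain ⟨g, hg, hgpos⟩ := riesz_extension (PointedCone.positive ℝ C(K, ℝ))
    ⟨LinearMap.range Φ, f.comp (LinearMap.range Φ).subtype⟩
    (by
      rintro ⟨_, c, rfl⟩ hc
      have : (0 : C(K, ℝ)) ≤ Φ c := hc
      change 0 ≤ f (Φ c)
      rw [hf']
      exact hpos c fun u => this u)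
    (by
      intro y
      refine ⟨⟨‖y‖ • X o, ⟨Finsupp.single o ‖y‖, by simp [Φ]⟩⟩, ?_⟩
      change (0 : C(K, ℝ)) ≤ ‖y‖ • X o + y
      rw [hX1]
      intro u
      have := (abs_le.mp (y.norm_coe_le_norm u)).1
      simp
      linarith)
  have hgX : ∀ a, g (X a) = φ a := by
    intro a
    have := hg ⟨X a, ⟨Finsupp.single a 1, hX a⟩⟩
    rw [this]
    change f (X a) = φ a
    rw [← hX, hf', hF]
    simp
  let Λ : CompactlySupportedContinuousMap K ℝ →ₚ[ℝ] ℝ := PositiveLinearMap.mk₀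
    { toFun := fun k => g k.toContinuousMap
      map_add' := fun k l => by rw [← map_add]; rfl
      map_smul' := fun r k => by simp only [RingHom.id_apply]; rw [← map_smul]; rfl }
    (fun k hk => hgpos _ (show (0 : C(K, ℝ)) ≤ k.toContinuousMap from fun u => hk u))
  have hint : ∀ a, ∫ u, χ a u ∂(RealRMK.rieszMeasure Λ) = φ a := by
    intro a
    have := RealRMK.integral_rieszMeasure Λ
      (CompactlySupportedContinuousMap.continuousMapEquiv (X a))
    rw [← hgX]
    exact this
  refine ⟨RealRMK.rieszMeasure Λ, ⟨?_⟩, hint⟩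
  have h1 := hint o
  simp only [ho, ho1, integral_const, smul_eq_mul, mul_one, Measure.real] at h1
  rwa [ENNReal.toReal_eq_one_iff] at h1

/-! ### Laplace transforms as mixtures of characters -/

/-- The character `u ↦ ∏ₓ u x ^ a x` of the compact monoid `[0, 1] ^ E`. In the variable
`ψ = -2 log u` it is the exponential `exp (-(1/2) ∑ₓ a x * ψ x)`. -/
noncomputable def laplaceChar {E : Type*} (a : E →₀ ℝ≥0) : (E → unitInterval) →* ℝ where
  toFun u := a.prod fun x t => (u x : ℝ) ^ (t : ℝ)
  map_one' := by simp
  map_mul' u v := by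
    simp only [Finsupp.prod, Pi.mul_apply, Set.Icc.coe_mul, ← Finset.prod_mul_distrib]
    exact Finset.prod_congr rfl fun x _ => Real.mul_rpow (u x).2.1 (v x).2.1

theorem laplaceChar_apply {E : Type*} (a : E →₀ ℝ≥0) (u : E → unitInterval) :
    laplaceChar a u = a.prod fun x t => (u x : ℝ) ^ (t : ℝ) := rfl

theorem laplaceChar_nonneg {E : Type*} (a : E →₀ ℝ≥0) (u : E → unitInterval) :
    0 ≤ laplaceChar a u :=
  Finset.prod_nonneg fun x _ => Real.rpow_nonneg (u x).2.1 _

theorem continuous_laplaceChar {E : Type*} (a : E →₀ ℝ≥0) : Continuous (laplaceChar a) := by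
  change Continuous fun u : E → unitInterval => ∏ x ∈ a.support, (u x : ℝ) ^ (a x : ℝ)
  refine continuous_finsetProd _ fun x _ => ?_
  exact (continuous_subtype_val.comp (continuous_apply x)).rpow_const fun _ => .inr (a x).2

theorem laplaceChar_single {E : Type*} (x : E) (t : ℝ≥0) (u : E → unitInterval) :
    laplaceChar (Finsupp.single x t) u = (u x : ℝ) ^ (t : ℝ) := by
  rw [laplaceChar_apply, Finsupp.prod_single_index (by simp)]

theorem laplaceChar_add {E : Type*} (a b : E →₀ ℝ≥0) (u : E → unitInterval) :
    laplaceChar (a + b) u = laplaceChar a u * laplaceChar b u := by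
  classical
  simp only [laplaceChar_apply]
  refine Finsupp.prod_add_index' (by simp) fun x s t => ?_
  rw [NNReal.coe_add, Real.rpow_add_of_nonneg (u x).2.1 s.coe_nonneg t.coe_nonneg]

theorem laplaceChar_sum_single {E ι : Type*} (s : Finset ι) (x : ι → E) (α : ι → ℝ≥0)
    (u : E → unitInterval) :
    laplaceChar (∑ i ∈ s, Finsupp.single (x i) (α i)) u = ∏ i ∈ s, (u (x i) : ℝ) ^ (α i : ℝ) := by
  classical
  induction s using Finset.induction_on with
  | empty => simp [laplaceChar_apply]
  | insert i s hi ih =>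
    rw [Finset.sum_insert hi, Finset.prod_insert hi, laplaceChar_add, ih, laplaceChar_single]

/-- `exp (-h * a x)` is a mixture as a function of `a`: it is the value of the character at a
single point. -/
theorem isMixture_exp_neg {E : Type*} (x : E) {h : ℝ} (hh : 0 ≤ h) :
    IsMixture laplaceChar fun a : E →₀ ℝ≥0 => Real.exp (-(h * a x)) := by
  classical
  have := IsMixture.eval (χ := laplaceChar (E := E))
    (Function.update 1 x ⟨Real.exp (-h), (Real.exp_pos _).le, by simpa using hh⟩)
  convert this using 2 with a
  rw [laplaceChar_apply, Finsupp.prod]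
  by_cases hx : a x = 0
  · rw [Finset.prod_eq_one fun y hy => ?_]
    · simp [hx]
    · have : y ≠ x := by rintro rfl; simp [hx] at hy
      simp [this]
  · rw [Finset.prod_eq_single x (fun y _ hy => by simp [hy]) (by simp [hx])]
    simp [← Real.exp_mul]

/-! ### Determinants `|I + αG|` of a kernel with nonnegative resolvents -/

/-- The matrix of the kernel `g` on a finite set of points. -/
def kernelMatrix {E : Type*} (g : E → E → ℝ) (F : Finset E) : Matrix F F ℝ :=
  Matrix.of fun i j => g i j

/-- The determinant `|I + αG|` over a finite family of points, possibly with repetitions, in terms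
of a finite set containing these points: weights of equal points add up. -/
theorem det_one_add_diagonal_mul_eq {E ι : Type*} [Fintype ι] [DecidableEq ι] [DecidableEq E]
    (g : E → E → ℝ) (x : ι → E) (α : ι → ℝ≥0) (F : Finset E) (hF : ∀ i, x i ∈ F) :
    (1 + Matrix.diagonal (fun i => (α i : ℝ)) * Matrix.of fun i j => g (x i) (x j)).det =
      (1 + Matrix.diagonal (fun y : F => ((∑ i, Finsupp.single (x i) (α i) : E →₀ ℝ≥0) y : ℝ)) *
        kernelMatrix g F).det := by
  let M : Matrix ι F ℝ := Matrix.of fun i y => if (⟨x i, hF i⟩ : F) = y then 1 else 0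
  have h1 : (Matrix.of fun i j => g (x i) (x j)) = M * kernelMatrix g F * M.transpose := by
    ext i j
    simp [M, Matrix.mul_apply, kernelMatrix]
  have h2 : M.transpose * Matrix.diagonal (fun i => (α i : ℝ)) * M =
      Matrix.diagonal (fun y : F => ((∑ i, Finsupp.single (x i) (α i) : E →₀ ℝ≥0) y : ℝ)) := by
    ext y z
    rw [Matrix.mul_apply, Matrix.diagonal_apply]
    simp only [Matrix.mul_diagonal, Matrix.transpose_apply, M, Matrix.of_apply,
      Finsupp.coe_finsetSum, Finset.sum_apply, NNReal.coe_sum, Finsupp.single_apply]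
    split_ifs with hyz
    · subst hyz
      refine Finset.sum_congr rfl fun i _ => ?_
      simp only [Subtype.ext_iff]
      split_ifs <;> simp
    · refine Finset.sum_eq_zero fun i _ => ?_
      split_ifs with h h'
      · exact absurd (h.symm.trans h') hyz
      all_goals simp
  rw [h1, ← h2, ← Matrix.mul_assoc, Matrix.det_one_add_mul_comm]
  simp only [Matrix.mul_assoc]

/-- If `G` and its resolvents `U = G (1 + r G)⁻¹`, `r > 0`, are nonnegative, then `|I + αG| > 0` and
`|I + αG| ^ (-p)` is a Laplace transform. With `Q = r U` and a diagonal matrix `S`,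
`I + r (I - S) G = (I - S Q) (I + r G)`, so that `isMixture_det_one_sub_rpow` applies when
`S = exp (-α / r)`; and `r (I - S) → α` as `r → ∞`. -/
theorem isMixture_det_one_add_rpow {E : Type*} [DecidableEq E] (F : Finset E) (G : Matrix F F ℝ)
    (hG : ∀ i j, 0 ≤ G i j)
    (hU : ∀ r : ℝ, 0 < r → ∃ U : Matrix F F ℝ, (∀ i j, 0 ≤ U i j) ∧ U * (1 + r • G) = G)
    {p : ℝ} (hp : 0 ≤ p) :
    (∀ α : F → ℝ≥0, 0 < (1 + Matrix.diagonal (fun i => (α i : ℝ)) * G).det) ∧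
      IsMixture laplaceChar fun a : E →₀ ℝ≥0 =>
        (1 + Matrix.diagonal (fun i : F => (a i : ℝ)) * G).det ^ (-p) := by
  have key : ∀ r : ℝ, 0 < r → ∀ s : (E →₀ ℝ≥0) → F → ℝ,
      (∀ i, IsMixture laplaceChar fun a => s a i) → (∀ a i, s a i ≤ 1) →
      (∀ a, 0 < (1 + Matrix.diagonal (fun i => r * (1 - s a i)) * G).det) ∧
      IsMixture laplaceChar fun a : E →₀ ℝ≥0 =>
        (1 + Matrix.diagonal (fun i => r * (1 - s a i)) * G).det ^ (-p) := by
    intro r hr s hs hs1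
    obtain ⟨U, hU0, hUG⟩ := hU r hr
    let Q : Matrix F F ℝ := r • U
    have hQ0 : ∀ i j, 0 ≤ Q i j := fun i j => mul_nonneg hr.le (hU0 i j)
    have hQ : Q * (1 + r • G) = r • G := by simp only [Q, Matrix.smul_mul, hUG]
    -- the row sums of `1 + r G` form a strict supersolution for `Q`
    let w : F → ℝ := fun i => 1 + r * ∑ j, G i j
    have hw0 : ∀ i, 0 ≤ r * ∑ j, G i j := fun i =>
      mul_nonneg hr.le (Finset.sum_nonneg fun j _ => hG i j)
    have hQw : ∀ i, ∑ j, Q i j * w j = r * ∑ j, G i j := by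
      intro i
      have hw : w = (1 + r • G).mulVec 1 := by
        ext i; simp [w, Matrix.mulVec, dotProduct, Finset.mul_sum, Matrix.add_apply,
          Finset.sum_add_distrib, Matrix.one_apply]
      change Q.mulVec w i = _
      rw [hw, Matrix.mulVec_mulVec, hQ]
      simp [Matrix.mulVec, dotProduct, Finset.mul_sum]
    have sub : ∀ t : (E →₀ ℝ≥0) → F → ℝ,
        (∀ i, IsMixture laplaceChar fun a => t a i) → (∀ a i, t a i ≤ 1) →
        (∀ a, 0 < (1 - Matrix.diagonal (t a) * Q).det) ∧
        IsMixture laplaceChar fun a => (1 - Matrix.diagonal (t a) * Q).det ^ (-p) := by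
      intro t ht ht1
      refine isMixture_det_one_sub_rpow laplaceChar_nonneg hp F _ (fun i j => ?_) (fun _ => w)
        (fun _ i => ?_) (fun a i => ?_)
      · simp only [Matrix.diagonal_mul]
        exact (ht i).mul (.const (hQ0 i j))
      · simp only [w]; linarith [hw0 i]
      · simp only [Matrix.diagonal_mul, mul_assoc, ← Finset.mul_sum, hQw]
        have := mul_le_mul_of_nonneg_right (ht1 a i) (hw0 i)
        simp only [w]; linarith
    have hdet : ∀ t : F → ℝ, (1 + Matrix.diagonal (fun i => r * (1 - t i)) * G).det =
        (1 - Matrix.diagonal t * Q).det * (1 + r • G).det := by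
      intro t
      rw [← Matrix.det_mul, sub_mul, mul_assoc, hQ]
      congr 1
      ext i j
      simp only [Matrix.add_apply, Matrix.sub_apply, Matrix.one_mul, Matrix.diagonal_mul,
        Matrix.smul_apply, smul_eq_mul]
      ring
    have hGdet : 0 < (1 + r • G).det := by
      have h1 := (sub (fun _ _ => 1) (fun _ => .one) (fun _ _ => le_rfl)).1 0
      have h2 := hdet fun _ => 1
      have h3 : (1 + Matrix.diagonal (fun i : F => r * (1 - (1 : ℝ))) * G).det = 1 := by simp
      rw [h3] at h2
      by_contra hcon
      nlinarith
    obtain ⟨h1, h2⟩ := sub s hs hs1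
    refine ⟨fun a => by rw [hdet]; exact mul_pos (h1 a) hGdet, ?_⟩
    have := h2.mul (.const (Real.rpow_nonneg hGdet.le (-p)))
    convert this using 2 with a
    rw [hdet, Real.mul_rpow (h1 a).le hGdet.le]
  have hpos : ∀ α : F → ℝ≥0, 0 < (1 + Matrix.diagonal (fun i => (α i : ℝ)) * G).det := by
    intro α
    have hr : 0 < 1 + ∑ i, (α i : ℝ) := by positivity
    have hle : ∀ i, (α i : ℝ) / (1 + ∑ i, (α i : ℝ)) ≤ 1 := fun i => by
      rw [div_le_one hr]
      have := Finset.single_le_sum (f := fun i => (α i : ℝ)) (fun i _ => (α i).2)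
        (Finset.mem_univ i)
      linarith
    have := (key _ hr (fun _ i => 1 - α i / (1 + ∑ i, (α i : ℝ)))
      (fun i => .const (by linarith [hle i]))
      (fun _ i => by have : 0 ≤ (α i : ℝ) / (1 + ∑ i, (α i : ℝ)) := by positivity
                     linarith)).1 0
    convert this using 6 with i
    field_simp
    ring
  refine ⟨hpos, ?_⟩
  -- take `S = exp (-h α)` and `r = 1 / h`, and let `h` tend to `0` from the right
  refine IsMixture.of_tendsto (l := 𝓝[>] (0 : ℝ)) (f := fun h (a : E →₀ ℝ≥0) =>
    (1 + Matrix.diagonal (fun i : F => h⁻¹ * (1 - Real.exp (-(h * a i)))) * G).det ^ (-p)) ?_ ?_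
  · filter_upwards [self_mem_nhdsWithin] with h hh
    have hh : 0 < h := hh
    refine (key h⁻¹ (inv_pos.mpr hh) (fun a i => Real.exp (-(h * a i)))
      (fun i => isMixture_exp_neg _ hh.le) (fun a i => ?_)).2
    rw [Real.exp_le_one_iff, neg_nonpos]
    positivity
  · intro a
    refine Tendsto.rpow_const ?_ (.inl (hpos fun i => a i).ne')
    have hc : Continuous fun v : F → ℝ => (1 + Matrix.diagonal v * G).det := by
      fun_prop
    refine (hc.tendsto _).comp (tendsto_pi_nhds.mpr fun i => ?_)
    have hd : HasDerivAt (fun h : ℝ => -Real.exp (-(h * a i))) (a i : ℝ) 0 := by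
      have h1 : HasDerivAt (fun h : ℝ => -(h * (a i : ℝ))) (-(a i : ℝ)) 0 := by
        simpa using ((hasDerivAt_id' (0 : ℝ)).mul_const (a i : ℝ)).fun_neg
      simpa using h1.exp.fun_neg
    have := hd.tendsto_slope_zero
    refine (this.mono_left (nhdsWithin_mono _ fun h (hh : 0 < h) => hh.ne')).congr fun h => ?_
    simp only [zero_add, zero_mul, neg_zero, Real.exp_zero, smul_eq_mul]
    ring

/-! ### Permanental processes of a kernel with nonnegative resolvents -/

/-- A nonnegative kernel whose finite sections have nonnegative resolvents has permanental
processes of all indices `β > 0`. -/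
theorem exists_isPermanentalProcess {E : Type u} [DecidableEq E] (g : E → E → ℝ)
    (hg : ∀ x y, 0 ≤ g x y)
    (hU : ∀ (F : Finset E) (r : ℝ), 0 < r → ∃ U : Matrix F F ℝ, (∀ i j, 0 ≤ U i j) ∧
      U * (1 + r • kernelMatrix g F) = kernelMatrix g F)
    {β : ℝ} (hβ : 0 < β) :
    ∃ (Ω' : Type u) (_ : MeasurableSpace Ω') (μ : Measure Ω') (ψ : E → Ω' → ℝ),
      IsProbabilityMeasure μ ∧ IsPermanentalProcess μ ψ g β := by
  have hp : 0 < 1 / β := by positivity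
  -- the determinant over any finite set containing the support
  let D : Finset E → (E →₀ ℝ≥0) → ℝ := fun F a =>
    (1 + Matrix.diagonal (fun i : F => (a i : ℝ)) * kernelMatrix g F).det
  have hD : ∀ F, (∀ a, 0 < D F a) ∧ IsMixture laplaceChar fun a => D F a ^ (-(1 / β)) := by
    intro F
    obtain ⟨h1, h2⟩ := isMixture_det_one_add_rpow F (kernelMatrix g F) (fun i j => hg _ _) (hU F)
      hp.le
    exact ⟨fun a => h1 fun i => a i, h2⟩
  have hDeq : ∀ (n : ℕ) (x : Fin n → E) (α : Fin n → ℝ≥0) (F : Finset E), (∀ i, x i ∈ F) →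
      (1 + Matrix.diagonal (fun i => (α i : ℝ)) * Matrix.of fun i j => g (x i) (x j)).det =
        D F (∑ i, Finsupp.single (x i) (α i)) := fun n x α F hF =>
    det_one_add_diagonal_mul_eq g x α F hF
  have hDsupp : ∀ (a : E →₀ ℝ≥0) (F : Finset E), a.support ⊆ F → D a.support a = D F a := by
    intro a F hF
    have := det_one_add_diagonal_mul_eq g (fun y : a.support => (y : E)) (fun y => a y) F
      fun y => hF y.2
    rw [Finset.sum_coe_sort a.support fun y => Finsupp.single y (a y)] at this
    have ha : ∑ y ∈ a.support, Finsupp.single y (a y) = a := a.sum_single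
    rw [ha] at this
    exact this
  have hmix : IsMixture laplaceChar fun a => D a.support a ^ (-(1 / β)) := by
    intro c hc
    have := (hD (c.support.biUnion fun a => a.support)).2 c hc
    convert this using 1
    refine Finset.sum_congr rfl fun a ha => ?_
    simp only
    rw [hDsupp a _ (Finset.subset_biUnion_of_mem (fun a : E →₀ ℝ≥0 => a.support) ha)]
  let _ : MeasurableSpace (E → unitInterval) := borel _
  have : BorelSpace (E → unitInterval) := ⟨rfl⟩
  obtain ⟨μ, hμ, hint⟩ := hmix.exists_measure continuous_laplaceChar 0
    (fun u => by simp [laplaceChar_apply]) (by simp [D])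
  have hcont : ∀ x, Continuous fun u : E → unitInterval => (u x : ℝ) := fun x =>
    continuous_subtype_val.comp (continuous_apply x)
  -- `u ^ t ≤ 1 - 1_{u = 0}` for `t > 0`, and the integral of `u ^ t` tends to `1` as `t → 0`
  have hzero : ∀ x, ∀ᵐ u ∂μ, 0 < (u x : ℝ) := by
    intro x
    have hmeas : MeasurableSet {u : E → unitInterval | (u x : ℝ) = 0} :=
      (hcont x).measurable (measurableSet_singleton 0)
    have hle : ∀ t : ℝ≥0, 0 < t → (1 + t * g x x) ^ (-(1 / β)) ≤
        1 - μ.real {u : E → unitInterval | (u x : ℝ) = 0} := by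
      intro t ht
      have h1 := hint (Finsupp.single x t)
      have h2 := hDeq 1 (fun _ => x) (fun _ => t) {x} (by simp)
      have h3 := hDsupp (Finsupp.single x t) {x} Finsupp.support_single_subset
      simp only [Finset.univ_unique, Finset.sum_singleton] at h2
      rw [h3, ← h2] at h1
      simp only [Matrix.det_unique, Matrix.add_apply, Matrix.diagonal_mul, Matrix.one_apply_eq,
        Matrix.of_apply, laplaceChar_single] at h1
      rw [← h1, ← probReal_compl_eq_one_sub hmeas, ← integral_indicator_one hmeas.compl]
      refine integral_mono_of_nonneg (.of_forall fun u => Real.rpow_nonneg (u x).2.1 _)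
        ((integrable_const (1 : ℝ)).indicator hmeas.compl) (.of_forall fun u => ?_)
      by_cases hu : (u x : ℝ) = 0
      · simp only [hu, Real.zero_rpow (NNReal.coe_pos.mpr ht).ne']
        exact Set.indicator_nonneg (fun _ _ => zero_le_one) _
      · simp only [Set.indicator, mem_compl_iff, mem_ofPred_eq, hu, not_false_eq_true, if_true,
          Pi.one_apply]
        exact Real.rpow_le_one (u x).2.1 (u x).2.2 t.coe_nonneg
    have hlim : Tendsto (fun t : ℝ≥0 => (1 + (t : ℝ) * g x x) ^ (-(1 / β))) (𝓝[>] 0) (𝓝 1) := by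
      have h1 : Tendsto (fun t : ℝ≥0 => 1 + (t : ℝ) * g x x) (𝓝 0) (𝓝 1) := by
        have : Continuous fun t : ℝ≥0 => 1 + (t : ℝ) * g x x := by fun_prop
        simpa using this.tendsto 0
      have := (h1.rpow_const (p := -(1 / β)) (.inl one_ne_zero))
      rw [Real.one_rpow] at this
      exact this.mono_left nhdsWithin_le_nhds
    have h1 := le_of_tendsto hlim (eventually_mem_nhdsWithin.mono fun t ht => hle t ht)
    have h2 : μ.real {u : E → unitInterval | (u x : ℝ) = 0} = 0 :=
      le_antisymm (by linarith) measureReal_nonneg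
    rw [measureReal_eq_zero_iff] at h2
    have h3 : ∀ᵐ u ∂μ, (u x : ℝ) ≠ 0 := by
      rw [ae_iff]; simpa using h2
    filter_upwards [h3] with u hu
    exact lt_of_le_of_ne (u x).2.1 hu.symm
  have hlift : ∀ (n : ℕ) (α : Fin n → ℝ), (∀ i, 0 ≤ α i) →
      ∃ α' : Fin n → ℝ≥0, α = fun i => (α' i : ℝ) := fun n α hα => ⟨fun i => ⟨α i, hα i⟩, rfl⟩
  refine ⟨E → unitInterval, inferInstance, μ, fun x u => -2 * Real.log (u x), hμ, ?_, ?_, ?_, ?_⟩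
  · intro x
    exact (Real.measurable_log.comp (hcont x).measurable).const_mul _
  · intro x u
    have := Real.log_nonpos (u x).2.1 (u x).2.2
    linarith
  · intro n α x hα
    obtain ⟨α, rfl⟩ := hlift n α hα
    rw [hDeq n x α (Finset.univ.image x) (by simp)]
    exact (hD _).1 _
  · intro n α x hα
    obtain ⟨α, rfl⟩ := hlift n α hα
    have hae : ∀ᵐ u ∂μ, ∀ i, 0 < (u (x i) : ℝ) := ae_all_iff.mpr fun i => hzero (x i)
    have hs : (∑ i, Finsupp.single (x i) (α i) : E →₀ ℝ≥0).support ⊆ Finset.univ.image x := by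
      refine Finsupp.support_finsetSum.trans ?_
      intro y hy
      simp only [Finset.mem_biUnion] at hy
      obtain ⟨i, -, hi⟩ := hy
      have := Finsupp.support_single_subset hi
      simp only [Finset.mem_singleton] at this
      simp [this]
    rw [hDeq n x α (Finset.univ.image x) (by simp), neg_div, ← hDsupp _ _ hs, ← hint]
    refine integral_congr_ae ?_
    filter_upwards [hae] with u hu
    rw [laplaceChar_sum_single, Finset.mul_sum, Real.exp_sum]
    refine Finset.prod_congr rfl fun i _ => ?_
    rw [Real.rpow_def_of_pos (hu i)]
    congr 1
    ring

/-! ### Resolvents of the potential of a substochastic semigroup -/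

theorem Matrix.pow_apply_mem_Icc_of_substochastic {ι : Type*} [Fintype ι] [DecidableEq ι]
    {P : Matrix ι ι ℝ} (hP : ∀ i j, 0 ≤ P i j) (hP1 : ∀ i, ∑ j, P i j ≤ 1) (k : ℕ) (i j : ι) :
    (P ^ k) i j ∈ Icc (0 : ℝ) 1 := by
  induction k generalizing i j with
  | zero =>
    rw [pow_zero, Matrix.one_apply]
    split_ifs <;> simp
  | succ k ih =>
    rw [pow_succ', Matrix.mul_apply]
    refine ⟨Finset.sum_nonneg fun l _ => mul_nonneg (hP i l) (ih l j).1, ?_⟩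
    refine (Finset.sum_le_sum fun l _ => ?_).trans (hP1 i)
    exact mul_le_of_le_one_right (hP i l) (ih l j).2

/-- A truncated and normalized resolvent `T = (1 - q) ∑ₖ (q P) ^ k`, `q = 1 / (1 + s)`, of a
substochastic matrix. Truncating the Neumann series at `k < m` leaves the error `D = (q P) ^ m`. -/
theorem exists_approx_resolvent {ι : Type*} [Fintype ι] [DecidableEq ι]
    {P : Matrix ι ι ℝ} (hP : ∀ i j, 0 ≤ P i j) (hP1 : ∀ i, ∑ j, P i j ≤ 1) {s ε : ℝ} (hs : 0 < s)
    (hε : 0 < ε) :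
    ∃ T D : Matrix ι ι ℝ, (∀ i j, T i j ∈ Icc (0 : ℝ) 1) ∧ (∀ i j, D i j ∈ Icc (0 : ℝ) ε) ∧
      T * (1 - P) = s • (1 - D - T) := by
  have hs1 : 0 < 1 + s := by linarith
  let q : ℝ := 1 / (1 + s)
  have hq0 : 0 < q := by positivity
  have hq1 : q < 1 := by rw [div_lt_one hs1]; linarith
  obtain ⟨m, hm⟩ := exists_pow_lt_of_lt_one hε hq1
  have hPk := Matrix.pow_apply_mem_Icc_of_substochastic hP hP1
  have hT : ∀ i j, ((1 - q) • ∑ k ∈ Finset.range m, (q • P) ^ k) i j =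
      (1 - q) * ∑ k ∈ Finset.range m, q ^ k * (P ^ k) i j := by
    intro i j
    simp [Matrix.smul_apply, Matrix.sum_apply, smul_pow]
  refine ⟨(1 - q) • ∑ k ∈ Finset.range m, (q • P) ^ k, (q • P) ^ m, fun i j => ?_, fun i j => ?_,
    ?_⟩
  · rw [hT]
    constructor
    · exact mul_nonneg (by linarith) (Finset.sum_nonneg fun k _ =>
        mul_nonneg (by positivity) (hPk k i j).1)
    · have h1 : ∑ k ∈ Finset.range m, q ^ k * (P ^ k) i j ≤ ∑ k ∈ Finset.range m, q ^ k :=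
        Finset.sum_le_sum fun k _ => mul_le_of_le_one_right (by positivity) (hPk k i j).2
      have h2 := mul_neg_geom_sum q m
      have h3 : 0 ≤ q ^ m := by positivity
      have h4 := mul_le_mul_of_nonneg_left h1 (by linarith : 0 ≤ 1 - q)
      linarith
  · rw [smul_pow, Matrix.smul_apply, smul_eq_mul]
    have h3 : 0 ≤ q ^ m := by positivity
    exact ⟨mul_nonneg h3 (hPk m i j).1, (mul_le_of_le_one_right h3 (hPk m i j).2).trans hm.le⟩
  · have h := geom_sum_mul_neg (q • P) m
    set V := ∑ k ∈ Finset.range m, (q • P) ^ k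
    have hq : 1 - q = s * q := by simp only [q]; field_simp; ring
    have h5 : V * (1 - P) = q⁻¹ • (1 - (q • P) ^ m - (1 - q) • V) := by
      rw [← h]
      simp only [mul_sub, mul_one, Matrix.mul_smul, smul_sub, sub_smul, one_smul]
      simp only [smul_smul, inv_mul_cancel₀ hq0.ne', one_smul]
      abel
    rw [Matrix.smul_mul, h5, smul_smul, hq, mul_assoc, mul_inv_cancel₀ hq0.ne', mul_one]

/-- Let `P n` be substochastic with `G = W n + P n * G`, where `W n ≥ 0` is the part of the
potential `G` accumulated up to the level `1 / (n + 1)` of a clock, and suppose that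
`(n + 1) W n → P₀` where `P₀ G = G`. Then the resolvent `U = G (1 + r G)⁻¹` is nonnegative:
it is a limit of discrete resolvents. -/
theorem exists_nonneg_resolvent {ι : Type*} [Fintype ι] [DecidableEq ι]
    {G P₀ : Matrix ι ι ℝ} {P W : ℕ → Matrix ι ι ℝ}
    (hP : ∀ n i j, 0 ≤ P n i j) (hP1 : ∀ n i, ∑ j, P n i j ≤ 1) (hW : ∀ n i j, 0 ≤ W n i j)
    (hG : ∀ n, G = W n + P n * G)
    (hlim : ∀ i j, Tendsto (fun n : ℕ => ((n : ℝ) + 1) * W n i j) atTop (𝓝 (P₀ i j)))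
    (hP₀ : P₀ * G = G) {r : ℝ} (hr : 0 < r) :
    ∃ U : Matrix ι ι ℝ, (∀ i j, 0 ≤ U i j) ∧ U * (1 + r • G) = G := by
  have hn : ∀ n : ℕ, 0 < (n : ℝ) + 1 := fun n => by positivity
  choose T D hT hD hTD using fun n : ℕ =>
    exists_approx_resolvent (hP n) (hP1 n) (s := r / ((n : ℝ) + 1)) (ε := 1 / ((n : ℝ) + 1))
      (by have := hn n; positivity) (by have := hn n; positivity)
  -- the rescaled potential at clock level `1 / (n + 1)`
  let Z : ℕ → Matrix ι ι ℝ := fun n => ((n : ℝ) + 1) • W n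
  have hZ0 : ∀ n i j, 0 ≤ Z n i j := fun n i j => mul_nonneg (hn n).le (hW n i j)
  have hZ : ∀ i j, Tendsto (fun n => Z n i j) atTop (𝓝 (P₀ i j)) := hlim
  let U : ℕ → Matrix ι ι ℝ := fun n => r⁻¹ • (T n * Z n)
  have hU0 : ∀ n i j, 0 ≤ U n i j := fun n i j =>
    mul_nonneg (inv_nonneg.mpr hr.le) (Finset.sum_nonneg fun k _ =>
      mul_nonneg (hT n i k).1 (hZ0 n k j))
  have hU1 : ∀ n, U n = (1 - D n - T n) * G := by
    intro n
    have h1 : W n = (1 - P n) * G := by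
      rw [sub_mul, one_mul]; exact eq_sub_of_add_eq (hG n).symm
    have h2 : T n * Z n = r • ((1 - D n - T n) * G) := by
      simp only [Z]
      rw [Matrix.mul_smul, h1, ← mul_assoc, hTD, Matrix.smul_mul, smul_smul]
      congr 1
      have := (hn n).ne'
      field_simp
    simp only [U]
    rw [h2, smul_smul, inv_mul_cancel₀ hr.ne', one_smul]
  have hUeq : ∀ n, U n * (1 + r • G) = G - D n * G - T n * ((P₀ - Z n) * G) := by
    intro n
    rw [mul_add, mul_one, Matrix.mul_smul]
    have h1 : r • (U n * G) = T n * Z n * G := by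
      simp only [U]
      rw [Matrix.smul_mul, smul_smul, mul_inv_cancel₀ hr.ne', one_smul]
    rw [h1, hU1, sub_mul P₀, hP₀, mul_sub, sub_mul, sub_mul, one_mul, mul_assoc]
    abel
  have hD0 : ∀ i j, Tendsto (fun n => D n i j) atTop (𝓝 0) := fun i j =>
    squeeze_zero (fun n => (hD n i j).1) (fun n => (hD n i j).2)
      tendsto_one_div_add_atTop_nhds_zero_nat
  have hDG : ∀ i j, Tendsto (fun n => (D n * G) i j) atTop (𝓝 0) := by
    intro i j
    simp only [Matrix.mul_apply]
    have := tendsto_finsetSum Finset.univ fun k _ => (hD0 i k).mul_const (G k j)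
    simpa using this
  have hZG : ∀ i j, Tendsto (fun n => ((P₀ - Z n) * G) i j) atTop (𝓝 0) := by
    intro i j
    simp only [Matrix.mul_apply, Matrix.sub_apply]
    have := tendsto_finsetSum Finset.univ fun k _ =>
      (((hZ i k).const_sub (P₀ i k)).mul_const (G k j))
    simpa using this
  have hTG : ∀ i j, Tendsto (fun n => (T n * ((P₀ - Z n) * G)) i j) atTop (𝓝 0) := by
    intro i j
    rw [tendsto_zero_iff_abs_tendsto_zero]
    refine squeeze_zero (g := fun n => ∑ k, |((P₀ - Z n) * G) k j|) (fun n => abs_nonneg _)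
      (fun n => ?_) ?_
    · simp only [Function.comp]
      rw [Matrix.mul_apply]
      refine (Finset.abs_sum_le_sum_abs _ _).trans (Finset.sum_le_sum fun k _ => ?_)
      rw [abs_mul, abs_of_nonneg (hT n i k).1]
      exact mul_le_of_le_one_left (abs_nonneg _) (hT n i k).2
    · have := tendsto_finsetSum Finset.univ fun k _ => (hZG k j).abs
      simpa using this
  have hlimU : ∀ i j, Tendsto (fun n => (U n * (1 + r • G)) i j) atTop (𝓝 (G i j)) := by
    intro i j
    simp only [hUeq, Matrix.sub_apply]
    simpa using ((tendsto_const_nhds (x := G i j)).sub (hDG i j)).sub (hTG i j)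
  obtain ⟨C, hC⟩ : ∃ C : ι → ι → ℝ, ∀ n i j, U n i j ≤ C i j := by
    have : ∀ i j, ∃ C, ∀ n, U n i j ≤ C := by
      intro i j
      have h1 : ∀ n, U n i j ≤ r⁻¹ * ∑ k, Z n k j := fun n => by
        refine mul_le_mul_of_nonneg_left ?_ (inv_nonneg.mpr hr.le)
        rw [Matrix.mul_apply]
        exact Finset.sum_le_sum fun k _ => mul_le_of_le_one_left (hZ0 n k j) (hT n i k).2
      have h2 := (tendsto_finsetSum Finset.univ fun k _ => hZ k j).const_mul r⁻¹
      obtain ⟨C, hC⟩ := h2.bddAbove_range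
      exact ⟨C, fun n => (h1 n).trans (hC ⟨n, rfl⟩)⟩
    choose C hC using this
    exact ⟨C, fun n i j => hC i j n⟩
  obtain ⟨V, hV, φ, hφ, hVlim⟩ := (isCompact_Icc (a := (0 : ι → ι → ℝ)) (b := C)).tendsto_subseq
    (x := fun n i j => U n i j) fun n => ⟨fun i j => hU0 n i j, fun i j => hC n i j⟩
  have hVlim' : ∀ i j, Tendsto (fun n => U (φ n) i j) atTop (𝓝 (V i j)) := fun i j =>
    (tendsto_pi_nhds.mp ((tendsto_pi_nhds.mp hVlim) i)) j
  refine ⟨Matrix.of V, fun i j => hV.1 i j, ?_⟩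
  ext i j
  refine tendsto_nhds_unique ?_ ((hlimU i j).comp hφ.tendsto_atTop)
  simp only [Function.comp_def, Matrix.mul_apply, Matrix.of_apply]
  exact tendsto_finsetSum _ fun k _ => (hVlim' i k).mul_const _

/-! ### First passage of continuous nondecreasing paths -/

/-- A path of a continuous additive functional, restricted to its regularity properties. -/
structure IsClockPath (a : ℝ≥0 → ℝ≥0) : Prop where
  zero : a 0 = 0
  monotone : Monotone a
  continuous : Continuous a

/-- The time at which the path `a` exceeds the level `h`, as an infimum over a countable dense set
of times (so that it is measurable without any exceptional null set). -/
noncomputable def firstPassage (a : ℝ≥0 → ℝ≥0) (h : ℝ≥0) : WithTop ℝ≥0 :=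
  open Classical in ⨅ n, if h < a (TopologicalSpace.denseSeq ℝ≥0 n) then
    (TopologicalSpace.denseSeq ℝ≥0 n : WithTop ℝ≥0) else ⊤

/-- The value reached by `l` at the moment when the clock `a` exceeds the level `h` (the limit of
`l` if this never happens). -/
noncomputable def valueAtLevel (a l : ℝ≥0 → ℝ≥0) (h : ℝ≥0) : ℝ≥0∞ :=
  open Classical in ⨆ n, if a (TopologicalSpace.denseSeq ℝ≥0 n) ≤ h then
    (l (TopologicalSpace.denseSeq ℝ≥0 n) : ℝ≥0∞) else 0

/-- The limit of a nondecreasing path, as a supremum over a countable dense set of times. -/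
noncomputable def totalValue (l : ℝ≥0 → ℝ≥0) : ℝ≥0∞ :=
  ⨆ n, (l (TopologicalSpace.denseSeq ℝ≥0 n) : ℝ≥0∞)

theorem exists_denseSeq_between {s t : ℝ≥0} (h : s < t) :
    ∃ n, s < TopologicalSpace.denseSeq ℝ≥0 n ∧ TopologicalSpace.denseSeq ℝ≥0 n < t := by
  obtain ⟨_, ⟨n, rfl⟩, h1, h2⟩ := (TopologicalSpace.denseRange_denseSeq ℝ≥0).exists_between h
  exact ⟨n, h1, h2⟩

theorem firstPassage_lt_iff {a : ℝ≥0 → ℝ≥0} {h : ℝ≥0} {t : WithTop ℝ≥0} :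
    firstPassage a h < t ↔ ∃ n, (TopologicalSpace.denseSeq ℝ≥0 n : WithTop ℝ≥0) < t ∧
      h < a (TopologicalSpace.denseSeq ℝ≥0 n) := by
  classical
  rw [firstPassage, iInf_lt_iff]
  refine exists_congr fun n => ?_
  split_ifs with hn
  · simp [hn]
  · simp [hn]

theorem totalValue_eq_iSup {l : ℝ≥0 → ℝ≥0} (hl : Monotone l) :
    totalValue l = ⨆ t, (l t : ℝ≥0∞) := by
  refine le_antisymm (iSup_le fun n => le_iSup (fun t => (l t : ℝ≥0∞)) _) (iSup_le fun t => ?_)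
  obtain ⟨n, hn, -⟩ := exists_denseSeq_between (lt_add_one t)
  exact (ENNReal.coe_le_coe.mpr (hl hn.le)).trans
    (le_iSup (fun n => (l (TopologicalSpace.denseSeq ℝ≥0 n) : ℝ≥0∞)) n)

theorem valueAtLevel_le_totalValue (a l : ℝ≥0 → ℝ≥0) (h : ℝ≥0) :
    valueAtLevel a l h ≤ totalValue l := by
  classical
  refine iSup_mono fun n => ?_
  split_ifs
  · exact le_rfl
  · exact bot_le

theorem valueAtLevel_le {a l : ℝ≥0 → ℝ≥0} (hla : ∀ t, l t ≤ a t) (h : ℝ≥0) :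
    valueAtLevel a l h ≤ h := by
  classical
  refine iSup_le fun n => ?_
  split_ifs with hn
  · exact ENNReal.coe_le_coe.mpr ((hla _).trans hn)
  · exact bot_le

theorem valueAtLevel_eq_zero {a l : ℝ≥0 → ℝ≥0} {h : ℝ≥0} (hl : ∀ t, a t ≤ h → l t = 0) :
    valueAtLevel a l h = 0 := by
  classical
  refine le_antisymm (iSup_le fun n => ?_) bot_le
  split_ifs with hn
  · rw [hl _ hn]; simp
  · exact le_rfl

theorem totalValue_eq_add {l l' : ℝ≥0 → ℝ≥0} (hl : Monotone l) {s : ℝ≥0}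
    (h : ∀ t, l (s + t) = l s + l' t) : totalValue l = l s + totalValue l' := by
  rw [totalValue_eq_iSup hl, totalValue, ENNReal.add_iSup]
  refine le_antisymm (iSup_le fun t => ?_) (iSup_le fun n => ?_)
  · obtain ⟨n, hn, -⟩ := exists_denseSeq_between (lt_add_one t)
    refine le_iSup_of_le n ?_
    rw [← ENNReal.coe_add, ← h]
    exact ENNReal.coe_le_coe.mpr (hl (hn.le.trans le_add_self))
  · rw [← ENNReal.coe_add, ← h]
    exact le_iSup (fun t => (l t : ℝ≥0∞)) _

namespace IsClockPath

variable {a l : ℝ≥0 → ℝ≥0} {h s : ℝ≥0}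

theorem sum {ι : Type*} (F : Finset ι) {l : ι → ℝ≥0 → ℝ≥0} (hl : ∀ i ∈ F, IsClockPath (l i)) :
    IsClockPath fun t => ∑ i ∈ F, l i t where
  zero := Finset.sum_eq_zero fun i hi => (hl i hi).zero
  monotone _ _ hst := Finset.sum_le_sum fun i hi => (hl i hi).monotone hst
  continuous := continuous_finsetSum _ fun i hi => (hl i hi).continuous

theorem lt_apply (ha : IsClockPath a) (hs : firstPassage a h = s) {t : ℝ≥0} (hst : s < t) :
    h < a t := by
  have : firstPassage a h < t := by rw [hs]; exact_mod_cast hst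
  obtain ⟨n, hn, hn'⟩ := firstPassage_lt_iff.mp this
  exact hn'.trans_le (ha.monotone (by exact_mod_cast hn.le))

theorem apply_eq (ha : IsClockPath a) (hs : firstPassage a h = s) : a s = h := by
  refine le_antisymm ?_ ?_
  · by_contra! hlt
    have hpos : 0 < s := by
      refine pos_iff_ne_zero.mpr ?_
      rintro rfl
      simp [ha.zero] at hlt
    have hmem : {t | h < a t} ∈ 𝓝 s := (isOpen_lt continuous_const ha.continuous).mem_nhds hlt
    obtain ⟨c, hc, hcs⟩ := exists_Ioc_subset_of_mem_nhds hmem ⟨0, hpos⟩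
    obtain ⟨n, hn1, hn2⟩ := exists_denseSeq_between hc
    have : firstPassage a h < s := firstPassage_lt_iff.mpr
      ⟨n, by exact_mod_cast hn2, hcs ⟨hn1, hn2.le⟩⟩
    exact this.ne hs
  · by_contra! hlt
    have hmem : {t | a t < h} ∈ 𝓝 s := (isOpen_lt ha.continuous continuous_const).mem_nhds hlt
    obtain ⟨c, hc, hcs⟩ := exists_Ico_subset_of_mem_nhds hmem ⟨s + 1, lt_add_one s⟩
    obtain ⟨n, hn1, hn2⟩ := exists_denseSeq_between hc
    exact lt_asymm (ha.lt_apply hs hn1) (hcs ⟨hn1.le, hn2⟩)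

theorem apply_le_of_top (ha : IsClockPath a) (hs : firstPassage a h = ⊤) (t : ℝ≥0) : a t ≤ h := by
  by_contra! hlt
  obtain ⟨n, hn, -⟩ := exists_denseSeq_between (lt_add_one t)
  have : firstPassage a h < ⊤ := firstPassage_lt_iff.mpr
    ⟨n, WithTop.coe_lt_top _, hlt.trans_le (ha.monotone hn.le)⟩
  exact this.ne hs

theorem valueAtLevel_of_top (ha : IsClockPath a) (hs : firstPassage a h = ⊤) :
    valueAtLevel a l h = totalValue l := by
  simp [valueAtLevel, totalValue, ha.apply_le_of_top hs]

theorem valueAtLevel_eq (ha : IsClockPath a) (hl : IsClockPath l) (hs : firstPassage a h = s) :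
    valueAtLevel a l h = l s := by
  classical
  refine le_antisymm (iSup_le fun n => ?_) (le_of_forall_lt fun b hb => ?_)
  · split_ifs with hn
    · refine ENNReal.coe_le_coe.mpr (hl.monotone ?_)
      by_contra! hlt
      exact absurd (ha.lt_apply hs hlt) (not_lt.mpr hn)
    · exact bot_le
  · have hpos : 0 < s := by
      refine pos_iff_ne_zero.mpr ?_
      rintro rfl
      simp [hl.zero] at hb
    have hmem : {t | b < (l t : ℝ≥0∞)} ∈ 𝓝 s :=
      (isOpen_lt continuous_const (ENNReal.continuous_coe.comp hl.continuous)).mem_nhds hb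
    obtain ⟨c, hc, hcs⟩ := exists_Ioc_subset_of_mem_nhds hmem ⟨0, hpos⟩
    obtain ⟨n, hn1, hn2⟩ := exists_denseSeq_between hc
    refine lt_of_lt_of_le (hcs ⟨hn1, hn2.le⟩ :
      b < (l (TopologicalSpace.denseSeq ℝ≥0 n) : ℝ≥0∞)) ?_
    refine le_iSup_of_le n ?_
    rw [if_pos ((ha.monotone hn2.le).trans (ha.apply_eq hs).le)]

end IsClockPath

/-! ### The strong Markov property at first passage times of a clock -/

namespace StrongMarkovProcess

variable {E Ω : Type*} [TopologicalSpace E] [MeasurableSpace E] [OpensMeasurableSpace E]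
  [MeasurableSpace Ω]

/-- Points from which `A` increases immediately with positive probability. If `A` is a local time
at `y` this set is empty or `{y}`; it is measurable, even though `{y}` need not be. -/
def immediateSet (M : StrongMarkovProcess E Ω) (A : ℝ≥0 → Ω → ℝ≥0) : Set (WithCemetery E) :=
  {w | M.P w {ω | ∃ n : ℕ, A (1 / (n + 1)) ω = 0}ᶜ ≠ 0}

/-- The event that the process at time `T < ∞` is in `B`. -/
def hitEvent (M : StrongMarkovProcess E Ω) (T : Ω → WithTop ℝ≥0) (B : Set (WithCemetery E)) :
    Set Ω :=
  {ω | T ω ≠ ⊤ ∧ M.X ((T ω).untopD 0) ω ∈ B}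

theorem mem_hitEvent_iff {M : StrongMarkovProcess E Ω} {T : Ω → WithTop ℝ≥0}
    {B : Set (WithCemetery E)} {ω : Ω} {s : ℝ≥0} (hs : T ω = s) :
    ω ∈ M.hitEvent T B ↔ M.X s ω ∈ B := by
  change (T ω ≠ ⊤ ∧ M.X ((T ω).untopD 0) ω ∈ B) ↔ _
  rw [hs]
  exact and_iff_right WithTop.coe_ne_top

theorem exists_of_mem_hitEvent {M : StrongMarkovProcess E Ω} {T : Ω → WithTop ℝ≥0}
    {B : Set (WithCemetery E)} {ω : Ω} (h : ω ∈ M.hitEvent T B) :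
    ∃ s : ℝ≥0, T ω = s ∧ M.X s ω ∈ B := by
  obtain ⟨s, hs⟩ := WithTop.ne_top_iff_exists.mp h.1
  exact ⟨s, hs.symm, (mem_hitEvent_iff hs.symm).mp h⟩

theorem measurableSet_hitEvent (M : StrongMarkovProcess E Ω) {T : Ω → WithTop ℝ≥0}
    (hT : IsStoppingTime M.filtration T) {B : Set (WithCemetery E)} (hB : MeasurableSet B) :
    MeasurableSet (M.hitEvent T B) :=
  hT.measurableSpace_le _ (M.measurable_X_stopping T hT B hB)

/-- The strong Markov property on the event `X_T ∈ B`. -/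
theorem measure_hitEvent_inter (M : StrongMarkovProcess E Ω) {T : Ω → WithTop ℝ≥0}
    (hT : IsStoppingTime M.filtration T) {B : Set (WithCemetery E)} (hB : MeasurableSet B)
    (x : WithCemetery E) {Γ : Set Ω} (hΓ : MeasurableSet Γ) {c : ℝ≥0∞}
    (hc : ∀ w ∈ B, M.P w Γ = c) :
    M.P x (M.hitEvent T B ∩ {ω | T ω ≠ ⊤ ∧ M.shift ((T ω).untopD 0) ω ∈ Γ}) =
      c * M.P x (M.hitEvent T B) := by
  have hinter : M.hitEvent T B ∩ {ω | T ω ≠ ⊤} = M.hitEvent T B :=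
    inter_eq_left.mpr fun ω hω => hω.1
  rw [M.strong_markov T hT x (M.hitEvent T B) Γ (M.measurable_X_stopping T hT B hB) hΓ,
    hinter, setLIntegral_congr_fun (M.measurableSet_hitEvent hT hB)
    (fun ω (hω : ω ∈ M.hitEvent T B) => hc _ hω.2), setLIntegral_const]

theorem isClockPath_ae {M : StrongMarkovProcess E Ω} {A : ℝ≥0 → Ω → ℝ≥0}
    (hA : M.IsContinuousAdditiveFunctional A) (x : WithCemetery E) :
    ∀ᵐ ω ∂(M.P x), IsClockPath fun t => A t ω := by
  filter_upwards [hA.zero x, hA.monotone x, hA.continuous x] with ω h0 h1 h2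
  exact ⟨h0, h1, h2⟩

theorem measurable_apply {M : StrongMarkovProcess E Ω} {A : ℝ≥0 → Ω → ℝ≥0}
    (hA : M.IsContinuousAdditiveFunctional A) (t : ℝ≥0) : Measurable (A t) :=
  (hA.adapted t).mono (M.filtration.le t) le_rfl

theorem measurableSet_stay {M : StrongMarkovProcess E Ω} {A : ℝ≥0 → Ω → ℝ≥0}
    (hA : M.IsContinuousAdditiveFunctional A) :
    MeasurableSet {ω | ∃ n : ℕ, A (1 / (n + 1)) ω = 0} := by
  rw [ofPred_exists]
  exact MeasurableSet.iUnion fun n => measurable_apply hA _ (measurableSet_singleton 0)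

theorem measurableSet_immediateSet {M : StrongMarkovProcess E Ω} {A : ℝ≥0 → Ω → ℝ≥0}
    (hA : M.IsContinuousAdditiveFunctional A) : MeasurableSet (M.immediateSet A) :=
  (M.P.measurable_coe (measurableSet_stay hA).compl) (measurableSet_singleton 0).compl

theorem eq_of_mem_immediateSet {M : StrongMarkovProcess E Ω} {A : ℝ≥0 → Ω → ℝ≥0} {y : E}
    (hA : M.IsLocalTimeAt y A) {w : WithCemetery E} (hw : w ∈ M.immediateSet A) :
    w = Sum.inl y := by
  by_contra hne
  refine hw ?_
  rw [← mem_ae_iff]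
  filter_upwards [hA.support w hne, hA.monotone w] with ω ⟨t, ht, h0⟩ hmono
  obtain ⟨n, hn⟩ := exists_nat_one_div_lt (K := ℝ) (NNReal.coe_pos.mpr ht)
  refine ⟨n, le_antisymm ?_ bot_le⟩
  rw [← h0]
  refine hmono (?_ : (1 / ((n : ℝ≥0) + 1)) ≤ t)
  rw [← NNReal.coe_le_coe]
  push_cast
  exact hn.le

/-- If `X_T` is not a point from which `A` increases immediately, then `A` does not increase
immediately after `T`. -/
theorem ae_exists_eq_of_notMem_immediateSet {M : StrongMarkovProcess E Ω} {A : ℝ≥0 → Ω → ℝ≥0}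
    (hA : M.IsContinuousAdditiveFunctional A) {T : Ω → WithTop ℝ≥0}
    (hT : IsStoppingTime M.filtration T) (x : WithCemetery E) :
    ∀ᵐ ω ∂(M.P x), ∀ s : ℝ≥0, T ω = s → M.X s ω ∉ M.immediateSet A →
      ∃ ε, 0 < ε ∧ A (s + ε) ω = A s ω := by
  have h0 := M.measure_hitEvent_inter hT (measurableSet_immediateSet hA).compl x
    (measurableSet_stay hA).compl (c := 0) (fun w hw => not_not.mp hw)
  rw [zero_mul, measure_eq_zero_iff_ae_notMem] at h0
  filter_upwards [h0, hA.additive x] with ω h1 hadd s hs hX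
  have h2 : ω ∈ M.hitEvent T (M.immediateSet A)ᶜ := (mem_hitEvent_iff hs).mpr hX
  have h3 : M.shift s ω ∈ {ω | ∃ n : ℕ, A (1 / (n + 1)) ω = 0} := by
    by_contra hcon
    refine h1 ⟨h2, h2.1, ?_⟩
    rw [hs]
    exact hcon
  obtain ⟨n, hn⟩ := h3
  refine ⟨1 / (n + 1), by positivity, ?_⟩
  rw [hadd, hn, add_zero]

/-- The strong Markov property for the total value of an additive functional after `T`: on the
event `X_T ∈ B`, where `B ⊆ {z}`, its mean is `E_z(A_∞)`. The shift by `T` is not assumed to be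
measurable; a measurable version `H` of the shifted total value takes its place. -/
theorem setLIntegral_totalValue_shift {M : StrongMarkovProcess E Ω} {A : ℝ≥0 → Ω → ℝ≥0}
    (hA : M.IsContinuousAdditiveFunctional A) {T : Ω → WithTop ℝ≥0}
    (hT : IsStoppingTime M.filtration T) {B : Set (WithCemetery E)} (hB : MeasurableSet B)
    {z : WithCemetery E} (hBz : ∀ w ∈ B, w = z) (x : WithCemetery E)
    (hz : ∫⁻ ω, totalValue (fun t => A t ω) ∂(M.P z) < ∞)
    {H : Ω → ℝ≥0∞} (hH : Measurable H) (hHtop : ∀ᵐ ω ∂(M.P x), H ω < ∞)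
    (hHeq : ∀ᵐ ω ∂(M.P x), ∀ s : ℝ≥0, T ω = s →
      H ω = totalValue fun t => A t (M.shift s ω)) :
    ∫⁻ ω in M.hitEvent T B, H ω ∂(M.P x) =
      M.P x (M.hitEvent T B) * ∫⁻ ω, totalValue (fun t => A t ω) ∂(M.P z) := by
  have hf : Measurable fun ω => totalValue fun t => A t ω :=
    Measurable.iSup fun n => (measurable_apply hA _).coe_nnreal_ennreal
  set f : Ω → ℝ≥0∞ := fun ω => totalValue fun t => A t ω with hfdef
  have hlevel : ∀ t : ℝ, (M.P x).restrict (M.hitEvent T B) {ω | t < (H ω).toReal} =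
      M.P x (M.hitEvent T B) * M.P z {ω | t < (f ω).toReal} := by
    intro t
    have hmeas : MeasurableSet {ω | t < (f ω).toReal} :=
      measurableSet_lt measurable_const hf.ennreal_toReal
    rw [Measure.restrict_apply (measurableSet_lt measurable_const hH.ennreal_toReal), mul_comm,
      ← M.measure_hitEvent_inter hT hB x hmeas (fun w hw => by rw [hBz w hw])]
    refine measure_congr ?_
    filter_upwards [hHeq] with ω hω
    refine propext ⟨fun ⟨h1, h2⟩ => ?_, fun ⟨h1, h2⟩ => ?_⟩
    · obtain ⟨s, hs, -⟩ := exists_of_mem_hitEvent h2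
      refine ⟨h2, h2.1, ?_⟩
      have h1 : t < (H ω).toReal := h1
      rw [hω s hs] at h1
      rw [hs]
      exact h1
    · obtain ⟨s, hs, -⟩ := exists_of_mem_hitEvent h1
      refine ⟨?_, h1⟩
      have h3 := h2.2
      rw [hs] at h3
      change t < (H ω).toReal
      rw [hω s hs]
      exact h3
  have hcake : ∀ (μ : Measure Ω) (k : Ω → ℝ≥0∞), Measurable k → (∀ᵐ ω ∂μ, k ω < ∞) →
      ∫⁻ ω, k ω ∂μ = ∫⁻ t in Ioi (0 : ℝ), μ {ω | t < (k ω).toReal} := by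
    intro μ k hk hktop
    rw [← lintegral_eq_lintegral_meas_lt μ (.of_forall fun ω => ENNReal.toReal_nonneg)
      hk.ennreal_toReal.aemeasurable]
    refine lintegral_congr_ae ?_
    filter_upwards [hktop] with ω hω
    rw [ENNReal.ofReal_toReal hω.ne]
  rw [hcake _ H hH (ae_restrict_of_ae hHtop), hcake _ f hf (ae_lt_top hf hz.ne)]
  simp only [hlevel]
  have := M.isMarkovKernel
  rw [lintegral_const_mul']
  exact measure_ne_top _ _

end StrongMarkovProcess

/-! ### The process observed at the first passage times of a sum of local times -/

namespace StrongMarkovProcess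

/-- The sum of the local times at the points of `F`, used as a clock. -/
def clock {E Ω : Type*} (L : E → ℝ≥0 → Ω → ℝ≥0) (F : Finset E) (ω : Ω) (t : ℝ≥0) : ℝ≥0 :=
  ∑ z ∈ F, L z t ω

theorem apply_le_clock {E Ω : Type*} {L : E → ℝ≥0 → Ω → ℝ≥0} {F : Finset E} {y : E}
    (hy : y ∈ F) (ω : Ω) (t : ℝ≥0) : L y t ω ≤ clock L F ω t :=
  Finset.single_le_sum (f := fun z => L z t ω) (fun _ _ => bot_le) hy

theorem clock_eq_add_sum_erase {E Ω : Type*} [DecidableEq E] {L : E → ℝ≥0 → Ω → ℝ≥0}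
    {F : Finset E} {y : E} (hy : y ∈ F) (ω : Ω) (t : ℝ≥0) :
    clock L F ω t = L y t ω + ∑ z ∈ F.erase y, L z t ω :=
  (Finset.add_sum_erase F (fun z => L z t ω) hy).symm

variable {E Ω : Type*} [TopologicalSpace E] [MeasurableSpace E] [OpensMeasurableSpace E]
  [MeasurableSpace Ω]

/-- The first time at which the clock of `F` exceeds `h`. -/
noncomputable def passageTime (L : E → ℝ≥0 → Ω → ℝ≥0) (F : Finset E) (h : ℝ≥0) (ω : Ω) :
    WithTop ℝ≥0 :=
  firstPassage (clock L F ω) h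

/-- The event that the clock of `F` exceeds `h` and that the process is then at `z`, where `z` is a
point at which the local time increases immediately. -/
def passageEvent (M : StrongMarkovProcess E Ω) (L : E → ℝ≥0 → Ω → ℝ≥0) (F : Finset E) (h : ℝ≥0)
    (z : E) : Set Ω :=
  M.hitEvent (passageTime L F h) (M.immediateSet (L z))

variable {M : StrongMarkovProcess E Ω} {L : E → ℝ≥0 → Ω → ℝ≥0}

theorem isStoppingTime_passageTime (hL : ∀ y, M.IsLocalTimeAt y (L y)) (F : Finset E) (h : ℝ≥0) :
    IsStoppingTime M.filtration (passageTime L F h) := by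
  have := M.filtration_rightContinuous
  refine isStoppingTime_of_measurableSet_lt_of_isRightContinuous fun i => ?_
  have hset : {ω | passageTime L F h ω < i} =
      ⋃ n, ⋃ _ : TopologicalSpace.denseSeq ℝ≥0 n < i,
        {ω | h < clock L F ω (TopologicalSpace.denseSeq ℝ≥0 n)} := by
    ext ω
    simp only [passageTime, mem_ofPred_eq, firstPassage_lt_iff, mem_iUnion, WithTop.coe_lt_coe,
      exists_prop]
  rw [hset]
  refine MeasurableSet.iUnion fun n => MeasurableSet.iUnion fun hn => ?_
  refine M.filtration.mono hn.le _ ?_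
  have hmeas : Measurable[M.filtration (TopologicalSpace.denseSeq ℝ≥0 n)]
      fun ω => clock L F ω (TopologicalSpace.denseSeq ℝ≥0 n) :=
    Finset.measurable_fun_sum F fun z _ => (hL z).adapted _
  exact hmeas measurableSet_Ioi

theorem measurable_clock (hL : ∀ y, M.IsLocalTimeAt y (L y)) (F : Finset E) (t : ℝ≥0) :
    Measurable fun ω => clock L F ω t :=
  Finset.measurable_fun_sum F fun z _ =>
    measurable_apply (hL z).toIsContinuousAdditiveFunctional t

theorem measurable_totalValue (hL : ∀ y, M.IsLocalTimeAt y (L y)) (y : E) :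
    Measurable fun ω => totalValue fun t => L y t ω :=
  Measurable.iSup fun _ =>
    (measurable_apply (hL y).toIsContinuousAdditiveFunctional _).coe_nnreal_ennreal

theorem measurable_valueAtLevel (hL : ∀ y, M.IsLocalTimeAt y (L y)) (F : Finset E) (h : ℝ≥0)
    (y : E) : Measurable fun ω => valueAtLevel (clock L F ω) (fun t => L y t ω) h := by
  classical
  refine Measurable.iSup fun n => ?_
  refine Measurable.ite (measurableSet_le (measurable_clock hL F _) measurable_const) ?_
    measurable_const
  exact (measurable_apply (hL y).toIsContinuousAdditiveFunctional _).coe_nnreal_ennreal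

theorem measurableSet_passageEvent (hL : ∀ y, M.IsLocalTimeAt y (L y)) (F : Finset E) (h : ℝ≥0)
    (z : E) : MeasurableSet (M.passageEvent L F h z) :=
  M.measurableSet_hitEvent (isStoppingTime_passageTime hL F h)
    (measurableSet_immediateSet (hL z).toIsContinuousAdditiveFunctional)

theorem mem_passageEvent_iff {F : Finset E} {h : ℝ≥0} {z : E} {ω : Ω} {s : ℝ≥0}
    (hs : passageTime L F h ω = s) :
    ω ∈ M.passageEvent L F h z ↔ M.X s ω ∈ M.immediateSet (L z) :=
  mem_hitEvent_iff hs

theorem notMem_passageEvent_of_top {F : Finset E} {h : ℝ≥0} {z : E} {ω : Ω}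
    (hs : passageTime L F h ω = ⊤) : ω ∉ M.passageEvent L F h z :=
  fun hω => hω.1 hs

theorem eq_of_mem_passageEvent (hL : ∀ y, M.IsLocalTimeAt y (L y)) {F : Finset E} {h : ℝ≥0}
    {z z' : E} {ω : Ω} (hz : ω ∈ M.passageEvent L F h z) (hz' : ω ∈ M.passageEvent L F h z') :
    z = z' :=
  Sum.inl_injective ((eq_of_mem_immediateSet (hL z) hz.2).symm.trans
    (eq_of_mem_immediateSet (hL z') hz'.2))

theorem isClockPath_clock_ae (hL : ∀ y, M.IsLocalTimeAt y (L y)) (F : Finset E)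
    (x : WithCemetery E) :
    ∀ᵐ ω ∂(M.P x), (∀ z ∈ F, IsClockPath fun t => L z t ω) ∧ IsClockPath (clock L F ω) := by
  have h1 : ∀ᵐ ω ∂(M.P x), ∀ z ∈ F, IsClockPath fun t => L z t ω :=
    (ae_ball_iff F.countable_toSet).mpr fun z _ =>
      isClockPath_ae (hL z).toIsContinuousAdditiveFunctional x
  filter_upwards [h1] with ω hω
  exact ⟨hω, IsClockPath.sum F hω⟩

/-- Right after the first passage time, the local times at all points of `F` other than the
current position stay constant. -/
theorem ae_eventually_eq_of_notMem_passageEvent (hL : ∀ y, M.IsLocalTimeAt y (L y))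
    (F : Finset E) (h : ℝ≥0) (x : WithCemetery E) :
    ∀ᵐ ω ∂(M.P x), ∀ s : ℝ≥0, passageTime L F h ω = s →
      ∀ᶠ ε in 𝓝[>] (0 : ℝ≥0), ∀ z ∈ F, ω ∉ M.passageEvent L F h z →
        L z (s + ε) ω = L z s ω := by
  have h1 : ∀ᵐ ω ∂(M.P x), ∀ z ∈ F, ∀ s : ℝ≥0, passageTime L F h ω = s →
      M.X s ω ∉ M.immediateSet (L z) → ∃ ε, 0 < ε ∧ L z (s + ε) ω = L z s ω :=
    (ae_ball_iff F.countable_toSet).mpr fun z _ =>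
      ae_exists_eq_of_notMem_immediateSet (hL z).toIsContinuousAdditiveFunctional
        (isStoppingTime_passageTime hL F h) x
  filter_upwards [h1, isClockPath_clock_ae hL F x] with ω hω hpath s hs
  refine (Filter.eventually_all_finset F).mpr fun z hz => ?_
  by_cases hmem : ω ∈ M.passageEvent L F h z
  · exact .of_forall fun ε hε => absurd hmem hε
  · obtain ⟨ε₀, hε₀, heq⟩ := hω z hz s hs fun hX => hmem ((mem_passageEvent_iff hs).mpr hX)
    filter_upwards [Ioo_mem_nhdsGT hε₀] with ε hε _
    refine le_antisymm ?_ ((hpath.1 z hz).monotone le_self_add)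
    rw [← heq]
    exact (hpath.1 z hz).monotone (by gcongr; exact hε.2.le)

/-- At the first passage time the process is at one of the points of `F`: otherwise the clock
would stay constant for a while. -/
theorem ae_exists_mem_passageEvent (hL : ∀ y, M.IsLocalTimeAt y (L y)) (F : Finset E) (h : ℝ≥0)
    (x : WithCemetery E) :
    ∀ᵐ ω ∂(M.P x), ∀ s : ℝ≥0, passageTime L F h ω = s → ∃ z ∈ F, ω ∈ M.passageEvent L F h z := by
  filter_upwards [ae_eventually_eq_of_notMem_passageEvent hL F h x, isClockPath_clock_ae hL F x]
    with ω hω hpath s hs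
  by_contra! hcon
  obtain ⟨ε, hε, hε0⟩ := ((hω s hs).and self_mem_nhdsWithin).exists
  have h1 : clock L F ω (s + ε) = clock L F ω s :=
    Finset.sum_congr rfl fun z hz => hε z hz (hcon z hz)
  have h2 := hpath.2.lt_apply hs (lt_add_of_pos_right s hε0)
  rw [h1, hpath.2.apply_eq hs] at h2
  exact lt_irrefl _ h2

theorem green_eq_lintegral_totalValue (hL : ∀ y, M.IsLocalTimeAt y (L y)) (x y : E) :
    M.green L x y = ∫⁻ ω, totalValue (fun t => L y t ω) ∂(M.P (Sum.inl x)) := by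
  refine lintegral_congr_ae ?_
  filter_upwards [(hL y).monotone (Sum.inl x)] with ω hω
  exact (totalValue_eq_iSup hω).symm

/-- Decomposition of the Green function at the first passage time of the clock. -/
theorem green_eq_add_sum (hL : ∀ y, M.IsLocalTimeAt y (L y)) (hM : M.IsTransient L)
    (F : Finset E) (h : ℝ≥0) (x y : E) (hy : y ∈ F) :
    M.green L x y =
      (∫⁻ ω, valueAtLevel (clock L F ω) (fun t => L y t ω) h ∂(M.P (Sum.inl x))) +
        ∑ z ∈ F, M.P (Sum.inl x) (M.passageEvent L F h z) * M.green L z y := by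
  let V : Ω → ℝ≥0∞ := fun ω => valueAtLevel (clock L F ω) (fun t => L y t ω) h
  let T : Ω → ℝ≥0∞ := fun ω => totalValue fun t => L y t ω
  have hV : Measurable V := measurable_valueAtLevel hL F h y
  have hT : Measurable T := measurable_totalValue hL y
  have hH : Measurable fun ω => T ω - V ω := hT.sub hV
  have hTtop : ∀ᵐ ω ∂(M.P (Sum.inl x)), T ω < ∞ :=
    ae_lt_top hT (by rw [← green_eq_lintegral_totalValue hL]; exact (hM x y).ne)
  have hpt : ∀ᵐ ω ∂(M.P (Sum.inl x)), T ω = V ω +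
      ∑ z ∈ F, (M.passageEvent L F h z).indicator (fun ω => T ω - V ω) ω := by
    filter_upwards [ae_exists_mem_passageEvent hL F h (Sum.inl x),
      isClockPath_clock_ae hL F (Sum.inl x)] with ω hω hpath
    by_cases htop : passageTime L F h ω = ⊤
    · have h1 : V ω = T ω := hpath.2.valueAtLevel_of_top htop
      rw [Finset.sum_eq_zero, add_zero, h1]
      exact fun z _ => indicator_of_notMem (notMem_passageEvent_of_top htop) _
    · obtain ⟨s, hs⟩ := WithTop.ne_top_iff_exists.mp htop
      obtain ⟨z, hz, hzω⟩ := hω s hs.symm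
      rw [Finset.sum_eq_single z, indicator_of_mem hzω,
        add_tsub_cancel_of_le (valueAtLevel_le_totalValue _ _ _)]
      · intro z' _ hne
        exact indicator_of_notMem (fun hz' => hne (eq_of_mem_passageEvent hL hz' hzω)) _
      · exact fun hcon => absurd hz hcon
  have hshift : ∀ᵐ ω ∂(M.P (Sum.inl x)), ∀ s : ℝ≥0, passageTime L F h ω = s →
      T ω - V ω = totalValue fun t => L y t (M.shift s ω) := by
    filter_upwards [isClockPath_clock_ae hL F (Sum.inl x), (hL y).additive (Sum.inl x)]
      with ω hpath hadd s hs
    have h1 : V ω = L y s ω := hpath.2.valueAtLevel_eq (hpath.1 y hy) hs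
    have h2 : T ω = L y s ω + totalValue fun t => L y t (M.shift s ω) :=
      totalValue_eq_add (hpath.1 y hy).monotone fun t => hadd t s
    rw [h1, h2, ENNReal.add_sub_cancel_left ENNReal.coe_ne_top]
  rw [green_eq_lintegral_totalValue hL, lintegral_congr_ae hpt, lintegral_add_left hV,
    lintegral_finsetSum _ fun z _ => hH.indicator (measurableSet_passageEvent hL F h z)]
  congr 1
  refine Finset.sum_congr rfl fun z _ => ?_
  rw [lintegral_indicator (measurableSet_passageEvent hL F h z), green_eq_lintegral_totalValue hL]
  refine setLIntegral_totalValue_shift (hL y).toIsContinuousAdditiveFunctional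
    (isStoppingTime_passageTime hL F h)
    (measurableSet_immediateSet (hL z).toIsContinuousAdditiveFunctional)
    (fun w hw => eq_of_mem_immediateSet (hL z) hw) _ ?_ hH ?_ hshift
  · rw [← green_eq_lintegral_totalValue hL]; exact hM z y
  · exact hTtop.mono fun ω hω => tsub_le_self.trans_lt hω

/-- The local time at `y` collected while the clock runs from `0` to a small level `h` is
asymptotically `h` times the probability that the clock starts running at `y`. -/
theorem tendsto_lintegral_valueAtLevel (hL : ∀ y, M.IsLocalTimeAt y (L y)) (F : Finset E)
    (x : WithCemetery E) (y : E) (hy : y ∈ F) :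
    Tendsto (fun n : ℕ => ((n : ℝ≥0) + 1 : ℝ≥0) *
        ∫⁻ ω, valueAtLevel (clock L F ω) (fun t => L y t ω) (1 / ((n : ℝ≥0) + 1)) ∂(M.P x))
      atTop (𝓝 (M.P x (M.passageEvent L F 0 y))) := by
  classical
  have := M.isMarkovKernel
  have hinv : ∀ n : ℕ,
      (((n : ℝ≥0) + 1 : ℝ≥0) : ℝ≥0∞) * ((1 / ((n : ℝ≥0) + 1) : ℝ≥0) : ℝ≥0∞) = 1 := by
    intro n
    rw [← ENNReal.coe_mul, mul_one_div_cancel (by positivity), ENNReal.coe_one]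
  have hsmall : ∀ c : ℝ≥0, 0 < c → ∀ᶠ n : ℕ in atTop, 1 / ((n : ℝ≥0) + 1) < c := fun c hc =>
    (tendsto_one_div_add_atTop_nhds_zero_nat (𝕜 := ℝ≥0)).eventually_lt_const hc
  rw [← lintegral_indicator_one (measurableSet_passageEvent hL F 0 y)]
  simp only [← lintegral_const_mul _ (measurable_valueAtLevel hL F _ y)]
  refine tendsto_lintegral_of_dominated_convergence (fun _ => 1)
    (fun n => (measurable_valueAtLevel hL F _ y).const_mul _) (fun n => .of_forall fun ω => ?_)
    (by simp) ?_
  · exact (mul_le_mul' le_rfl (valueAtLevel_le (apply_le_clock hy ω) _)).trans (hinv n).le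
  filter_upwards [ae_exists_mem_passageEvent hL F 0 x, isClockPath_clock_ae hL F x,
    ae_eventually_eq_of_notMem_passageEvent hL F 0 x] with ω hex hpath hstay
  -- the clock never starts
  by_cases htop : passageTime L F 0 ω = ⊤
  · rw [indicator_of_notMem (notMem_passageEvent_of_top htop)]
    refine tendsto_const_nhds.congr fun n => ?_
    rw [valueAtLevel_eq_zero fun t _ => ?_, mul_zero]
    exact le_antisymm ((apply_le_clock hy ω t).trans (hpath.2.apply_le_of_top htop t)) bot_le
  obtain ⟨s, hs'⟩ := WithTop.ne_top_iff_exists.mp htop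
  have hs : passageTime L F 0 ω = s := hs'.symm
  obtain ⟨ε, hε, hε0⟩ := ((hstay s hs).and self_mem_nhdsWithin).exists
  have hclock : 0 < clock L F ω (s + ε) := hpath.2.lt_apply hs (lt_add_of_pos_right s hε0)
  -- off the current position, the local times vanish up to time `s + ε`
  have hzero : ∀ z ∈ F, ω ∉ M.passageEvent L F 0 z → ∀ t ≤ s + ε, L z t ω = 0 := by
    intro z hz hmem t ht
    refine le_antisymm (((hpath.1 z hz).monotone ht).trans ?_) bot_le
    rw [hε z hz hmem, ← hpath.2.apply_eq hs]
    exact apply_le_clock hz ω s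
  have hbefore : ∀ {c t : ℝ≥0}, c < clock L F ω (s + ε) → clock L F ω t ≤ c → t ≤ s + ε := by
    intro c t hc ht
    by_contra! hlt
    exact absurd (ht.trans_lt hc) (not_lt.mpr (hpath.2.monotone hlt.le))
  by_cases hmem : ω ∈ M.passageEvent L F 0 y
  -- if the clock starts at `y`, it coincides with the local time at `y` for a while
  · rw [indicator_of_mem hmem]
    refine tendsto_const_nhds.congr' ?_
    filter_upwards [hsmall _ hclock] with n hn
    have hne : passageTime L F (1 / ((n : ℝ≥0) + 1)) ω ≠ ⊤ := fun htop' =>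
      absurd hn (not_lt.mpr (hpath.2.apply_le_of_top htop' _))
    obtain ⟨s', hs''⟩ := WithTop.ne_top_iff_exists.mp hne
    have h1 : clock L F ω s' = 1 / ((n : ℝ≥0) + 1) := hpath.2.apply_eq hs''.symm
    have h2 : L y s' ω = 1 / ((n : ℝ≥0) + 1) := by
      rw [← h1, clock_eq_add_sum_erase hy, Finset.sum_eq_zero, add_zero]
      intro z hz
      refine hzero z (Finset.mem_of_mem_erase hz) (fun hz' => ?_) s' (hbefore hn h1.le)
      exact Finset.ne_of_mem_erase hz (eq_of_mem_passageEvent hL hz' hmem)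
    rw [hpath.2.valueAtLevel_eq (hpath.1 y hy) hs''.symm, h2, hinv]
    rfl
  · rw [indicator_of_notMem hmem]
    refine tendsto_const_nhds.congr' ?_
    filter_upwards [hsmall _ hclock] with n hn
    rw [valueAtLevel_eq_zero fun t ht => hzero y hy hmem t (hbefore hn ht), mul_zero]

/-- The resolvents of the Green function on a finite set are nonnegative. -/
theorem exists_nonneg_resolvent_green [DecidableEq E] (hL : ∀ y, M.IsLocalTimeAt y (L y))
    (hM : M.IsTransient L) (F : Finset E) {r : ℝ} (hr : 0 < r) :
    ∃ U : Matrix F F ℝ, (∀ i j, 0 ≤ U i j) ∧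
      U * (1 + r • kernelMatrix (fun x y => (M.green L x y).toReal) F) =
        kernelMatrix (fun x y => (M.green L x y).toReal) F := by
  have := M.isMarkovKernel
  let P : ℝ≥0 → Matrix F F ℝ := fun h => Matrix.of fun i j =>
    (M.P (Sum.inl i)).real (M.passageEvent L F h j)
  let W : ℝ≥0 → Matrix F F ℝ := fun h => Matrix.of fun i j =>
    (∫⁻ ω, valueAtLevel (clock L F ω) (fun t => L j t ω) h ∂(M.P (Sum.inl i))).toReal
  have hWtop : ∀ (h : ℝ≥0) (x : E) (y : E), y ∈ F →
      ∫⁻ ω, valueAtLevel (clock L F ω) (fun t => L y t ω) h ∂(M.P (Sum.inl x)) ≤ h := by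
    intro h x y hy
    calc _ ≤ ∫⁻ _, (h : ℝ≥0∞) ∂(M.P (Sum.inl x)) :=
          lintegral_mono fun ω => valueAtLevel_le (apply_le_clock hy ω) h
      _ = h := by simp
  have hdec : ∀ h, kernelMatrix (fun x y => (M.green L x y).toReal) F =
      W h + P h * kernelMatrix (fun x y => (M.green L x y).toReal) F := by
    intro h
    ext i j
    have h1 := congrArg ENNReal.toReal (green_eq_add_sum hL hM F h i j j.2)
    rw [ENNReal.toReal_add ((hWtop h i j j.2).trans_lt ENNReal.coe_lt_top).ne
      (ENNReal.sum_ne_top.mpr fun z _ => ENNReal.mul_ne_top (measure_ne_top _ _) (hM z j).ne),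
      ENNReal.toReal_sum fun z _ => ENNReal.mul_ne_top (measure_ne_top _ _) (hM z j).ne] at h1
    simp only [ENNReal.toReal_mul] at h1
    rw [← Finset.sum_coe_sort F] at h1
    exact h1
  refine exists_nonneg_resolvent (P₀ := P 0) (P := fun n => P (1 / ((n : ℝ≥0) + 1)))
    (W := fun n => W (1 / ((n : ℝ≥0) + 1))) (fun n i j => measureReal_nonneg) (fun n i => ?_)
    (fun n i j => ENNReal.toReal_nonneg) (fun n => hdec _) (fun i j => ?_) ?_ hr
  · have hdisj : Pairwise (Function.onFun Disjoint fun j : F =>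
        M.passageEvent L F (1 / ((n : ℝ≥0) + 1)) j) := fun j k hjk =>
      disjoint_left.mpr fun ω hj hk => hjk (Subtype.ext (eq_of_mem_passageEvent hL hj hk))
    simp only [P, Matrix.of_apply]
    rw [← measureReal_iUnion_fintype hdisj fun j => measurableSet_passageEvent hL F _ j]
    exact measureReal_le_one
  · have h1 := (ENNReal.tendsto_toReal (measure_ne_top _ _)).comp
      (tendsto_lintegral_valueAtLevel hL F (Sum.inl i) j j.2)
    refine h1.congr fun n => ?_
    simp only [Function.comp, ENNReal.toReal_mul, ENNReal.coe_toReal, NNReal.coe_add,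
      NNReal.coe_natCast, NNReal.coe_one]
    rfl
  -- nothing is collected before the clock starts, so that `P 0` fixes the Green function
  · have hW0 : W 0 = 0 := by
      ext i j
      simp only [W, Matrix.of_apply, Matrix.zero_apply]
      rw [nonpos_iff_eq_zero.mp ((hWtop 0 i j j.2).trans_eq ENNReal.coe_zero), ENNReal.toReal_zero]
    have := hdec 0
    rw [hW0, zero_add] at this
    exact this.symm

end StrongMarkovProcess

theorem theoremT1 {E : Type u} {Ω : Type v} [TopologicalSpace E] [MeasurableSpace E]
    [OpensMeasurableSpace E] [MeasurableSpace Ω] (M : StrongMarkovProcess E Ω)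
    (L : E → ℝ≥0 → Ω → ℝ≥0) (hL : ∀ y, M.IsLocalTimeAt y (L y)) (hM : M.IsTransient L)
    (β : ℝ) (hβ : 0 < β) :
    ∃ (Ω' : Type u) (_ : MeasurableSpace Ω') (μ : Measure Ω') (ψ : E → Ω' → ℝ),
      IsProbabilityMeasure μ ∧
        IsPermanentalProcess μ ψ (fun x y => (M.green L x y).toReal) β := by
  classical
  exact exists_isPermanentalProcess _ (fun _ _ => ENNReal.toReal_nonneg)
    (fun F _ hr => StrongMarkovProcess.exists_nonneg_resolvent_green hL hM F hr) hβ
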